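/- Let $K$ be a number field, let $f\in\mathcal O_K[X]$ be a square-free monic polynomial of odd degree at least $3$, and let $\mathcal S$ be a finite set of nonzero prime ideals of $\mathcal O_K$ such that the ring of $\mathcal S$-integers $R=\mathcal O_{K,\mathcal S}$ is a PID. **Forms.** For a commutative ring $R'$, the form $[a,b,c]=ax^2+bxy+cy^2$ with $a,b,c\in R'$ is *primitive* if $a,b,c$ generate the unit ideal, and its discriminant is $b^2-4ac$. Two forms $q,q'$ are *equivalent* over $R'$ if $q'=\frac1{\det M}\,(q\circ M)$ for some $M\in\mathrm{GL}_2(R')$. For a form $q$ of discriminant $4f$ over $K[X]$, let $H_q\subseteq (K[X]/(4f))^\times$ be the set of invertible values modulo $4f$ of the forms equivalent to $q$; the genus map sends the class of $q$ to the coset $H_q$ of $H_0:=H_{[1,0,-f]}$, and $q$ is *in the principal genus* over $K[X]$ if it lies in the kernel, i.e. if $H_q=H_0$. **Density.** A *density* on $R$ is a map $\delta$ from the set of subsets of $R$ to $[0,1]$ such that $\delta(R)=1$; $\delta(P)\le\delta(Q)$ if $P\subseteq Q$; $\delta(P\cup Q)\le\delta(P)+\delta(Q)$; $\delta(\alpha+P)=\delta(P)$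 for all $\alpha\in R$; and $\delta(I)=1/|R/I|$ for every ideal $I$ of $R$ (read as $0$ if $R/I$ is infinite). Let $\delta$ be a density on $R$, and let $[A,2B,C]$ be a primitive form over $R[X]$ of discriminant $4f$, with $A$ coprime to $f$ in $K[X]$. Assume that $[A,2B,C]$ is not in the principal genus over $K[X]$. Then the group $R^\times/R^{\times 2}$ is finite, and for every $\varepsilon\in R^\times$ there is a root $\rho_\varepsilon$ of $f$ in an algebraic closure of $K$ such that $\varepsilon A(\rho_\varepsilon)$ is not a square in the ring of $\mathcal S_\varepsilon$-integers of $K(\rho_\varepsilon)$, where $\mathcal S_\varepsilon$ is the set of primes of $K(\rho_\varepsilon)$ above $\mathcal S$. For any choice of representatives $\varepsilon$ of $R^\times/R^{\times 2}$ and of such roots $\rho_\varepsilon$, let $\mathcal P_\varepsilon$ be the set of nonzero primes $\mathfrak p$ of $K(\rho_\varepsilon)$ that are not above $\mathcal S$, have inertia degree $1$ over $K$, and are inert in $K\big(\rho_\varepsilon,\sqrt{\varepsilon A(\rho_\varepsilon)}\big)$. Let $$\mathcal T_{triv}=\{n\in R : [A(n),2B(n),C(n)]\text{ is equivalent over } R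 \text{ to } [1,0,-f(n)]\}.$$ Then the (possibly infinite) products below converge, unconditionally, as limits of their finite partial products (the limit may be $0$), and $$\delta(\mathcal T_{triv})\ \le\ \sum_{\varepsilon\in R^\times/R^{\times2}}\ \prod_{\mathfrak p\in\mathcal P_\varepsilon}\Big(1-\frac1{N(\mathfrak p)}\Big).$$ -/

import Mathlib

open IsDedekindDomain NumberField Polynomial IntermediateField

/-- The binary quadratic form `[a, b, c] = a x² + b x y + c y²` with coefficients in `R`. -/
@[ext]
structure BinForm (R : Type*) where
  /-- coefficient of `x²` -/
  a : R
  /-- coefficient of `x y` -/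
  b : R
  /-- coefficient of `y²` -/
  c : R

namespace BinForm

/-- The value `q(x, y)`. -/
def eval {R : Type*} [CommRing R] (q : BinForm R) (x y : R) : R :=
  q.a * x ^ 2 + q.b * x * y + q.c * y ^ 2

/-- The discriminant `b² - 4ac`. -/
def disc {R : Type*} [CommRing R] (q : BinForm R) : R := q.b ^ 2 - 4 * q.a * q.c

/-- A form is primitive if its coefficients generate the unit ideal. -/
def IsPrimitive {R : Type*} [CommRing R] (q : BinForm R) : Prop :=
  Ideal.span {q.a, q.b, q.c} = ⊤

/-- Apply a ring homomorphism to the coefficients (base change, or specialization at `X = n`). -/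
def map {R R' : Type*} [CommRing R] [CommRing R'] (φ : R →+* R') (q : BinForm R) : BinForm R' :=
  ⟨φ q.a, φ q.b, φ q.c⟩

/-- The twisted action of `GL₂(R)` on forms, `M · q = (det M)⁻¹ (q ∘ M)`, on coefficients. -/
def twistedAct {R : Type*} [CommRing R] (M : GL (Fin 2) R) (q : BinForm R) : BinForm R :=
  let d : R := ((Matrix.GeneralLinearGroup.det M)⁻¹ : Rˣ)
  ⟨d * q.eval (M 0 0) (M 1 0),
   d * (2 * q.a * M 0 0 * M 0 1 + q.b * (M 0 0 * M 1 1 + M 0 1 * M 1 0) + 2 * q.c * M 1 0 * M 1 1),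
   d * q.eval (M 0 1) (M 1 1)⟩

theorem eval_twistedAct {R : Type*} [CommRing R] (M : GL (Fin 2) R) (q : BinForm R) (x y : R) :
    (twistedAct M q).eval x y = ((Matrix.GeneralLinearGroup.det M)⁻¹ : Rˣ) *
      q.eval (M 0 0 * x + M 0 1 * y) (M 1 0 * x + M 1 1 * y) := by
  simp only [twistedAct, eval]
  ring

/-- Twisted equivalence of forms over `R`. -/
def Equivalent {R : Type*} [CommRing R] (q q' : BinForm R) : Prop :=
  ∃ M : GL (Fin 2) R, q' = twistedAct M q

/-- The principal form `[1, 0, -f]` of discriminant `4f`. -/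
def principal {R : Type*} [CommRing R] (f : R) : BinForm R := ⟨1, 0, -f⟩

theorem disc_principal {R : Type*} [CommRing R] (f : R) : (principal f).disc = 4 * f := by
  simp only [disc, principal]
  ring

/-- `Val_Δ(q)`: the values of `q` on `R/ΔR` that are units of `R/ΔR`. -/
def vals {R : Type*} [CommRing R] (Δ : R) (q : BinForm R) : Set (R ⧸ Ideal.span {Δ})ˣ :=
  {u | ∃ x y : R ⧸ Ideal.span {Δ}, (u : R ⧸ Ideal.span {Δ}) = (q.map (Ideal.Quotient.mk _)).eval x y}

/-- `H_q`: the set of values in `(R/ΔR)ˣ` of the class of `q`, i.e. the union of `Val_Δ(q')`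
over all forms `q'` equivalent to `q`. -/
def classVals {R : Type*} [CommRing R] (Δ : R) (q : BinForm R) : Set (R ⧸ Ideal.span {Δ})ˣ :=
  ⋃ q' ∈ {q' : BinForm R | Equivalent q q'}, vals Δ q'

/-- A form of discriminant `4f` is in the principal genus. The genus map sends the class of `q` to
the coset `H_q` of `H_0 = H_{[1, 0, -f]}` in `(R/4fR)ˣ`, so its kernel consists of the classes
with `H_q = H_0`. -/
def InPrincipalGenus {R : Type*} [CommRing R] (f : R) (q : BinForm R) : Prop :=
  classVals (4 * f) q = classVals (4 * f) (principal f)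

end BinForm

/-- A density on a ring `R`: a normalized, monotone, finitely subadditive, translation invariant
map from subsets of `R` to `[0, 1]`, with `δ(I) = 1 / N(I)` for each ideal `I`, where
`N(I) = |R/I|`. If `R/I` is infinite, then `Nat.card (R ⧸ I) = 0` and the condition reads
`δ(I) = 0`, as it should. -/
structure IsDensity {R : Type*} [CommRing R] (δ : Set R → ℝ) : Prop where
  mem_Icc : ∀ P, δ P ∈ Set.Icc (0 : ℝ) 1
  univ : δ Set.univ = 1
  mono : ∀ P Q, P ⊆ Q → δ P ≤ δ Q
  union : ∀ P Q, δ (P ∪ Q) ≤ δ P + δ Q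
  translate : ∀ (α : R) (P : Set R), δ ((fun x => α + x) '' P) = δ P
  ideal : ∀ I : Ideal R, δ (I : Set R) = 1 / (Nat.card (R ⧸ I) : ℝ)

instance instNumberFieldAdjoinSimple (K : Type*) [Field K] [NumberField K]
    (ρ : AlgebraicClosure K) : NumberField K⟮ρ⟯ :=
  haveI : FiniteDimensional K K⟮ρ⟯ :=
    adjoin.finiteDimensional (Algebra.IsIntegral.isIntegral ρ)
  NumberField.of_module_finite K K⟮ρ⟯

/-- The set of primes of `L` lying over the primes of `K` in `S`. -/
def primesOver {K : Type*} [Field K] (S : Set (HeightOneSpectrum (𝓞 K)))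
    (L : Type*) [Field L] [Algebra K L] : Set (HeightOneSpectrum (𝓞 L)) :=
  {𝔭 | ∃ v ∈ S, 𝔭.asIdeal.LiesOver v.asIdeal}

/-- For `ρ` algebraic over `K` and `u` and `A` with `S`-integral coefficients, the element
`u A(ρ)` of `K(ρ)`. -/
noncomputable def valueAt {K : Type*} [Field K] [NumberField K] {S : Set (HeightOneSpectrum (𝓞 K))}
    (A : (S.integer K)[X]) (u : (S.integer K)ˣ) (ρ : AlgebraicClosure K) : K⟮ρ⟯ :=
  algebraMap (S.integer K) K⟮ρ⟯ u * aeval (AdjoinSimple.gen K ρ) A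

/-- `ρ` is a root of `f` such that `u A(ρ)` is not a square in the ring of `S'`-integers of `K(ρ)`,
where `S'` is the set of primes of `K(ρ)` above `S`. -/
def IsNonsquareRoot {K : Type*} [Field K] [NumberField K] {S : Set (HeightOneSpectrum (𝓞 K))}
    (f : (𝓞 K)[X]) (A : (S.integer K)[X]) (u : (S.integer K)ˣ) (ρ : AlgebraicClosure K) : Prop :=
  aeval ρ f = 0 ∧ ¬ ∃ y ∈ (primesOver S K⟮ρ⟯).integer K⟮ρ⟯, y ^ 2 = valueAt A u ρ

/-- For a number field `F` inside an algebraically closed field `Ω` and `d ∈ F`, the field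
`F(√d)`. -/
noncomputable abbrev sqrtExt {F Ω : Type*} [Field F] [Field Ω] [Algebra F Ω] (d : F) :
    IntermediateField F Ω :=
  IntermediateField.adjoin F {s : Ω | s ^ 2 = algebraMap F Ω d}

/-- The set of primes `𝔭` of `K(ρ)` not above `S`, of inertia degree one over `K`, and inert in
`K(ρ, √(u A(ρ)))`, i.e. generating a prime ideal there. -/
def inertPrimes {K : Type*} [Field K] [NumberField K] {S : Set (HeightOneSpectrum (𝓞 K))}
    (A : (S.integer K)[X]) (u : (S.integer K)ˣ) (ρ : AlgebraicClosure K) :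
    Set (HeightOneSpectrum (𝓞 K⟮ρ⟯)) :=
  {𝔭 | 𝔭 ∉ primesOver S K⟮ρ⟯ ∧
    𝔭.asIdeal.inertiaDeg (𝓞 K) = 1 ∧
    (𝔭.asIdeal.map (algebraMap (𝓞 K⟮ρ⟯)
      (𝓞 (sqrtExt (Ω := AlgebraicClosure K) (valueAt A u ρ))))).IsPrime}

/-- The set of `n` for which the specialization at `X = n` of the form `q`, of discriminant `4f`,
is equivalent to `[1, 0, -f(n)]`. -/
def trivialSpecializations {K : Type*} [Field K] [NumberField K]
    {S : Set (HeightOneSpectrum (𝓞 K))} (f : (𝓞 K)[X]) (q : BinForm (S.integer K)[X]) :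
    Set (S.integer K) :=
  {n | (q.map (evalRingHom n)).Equivalent (BinForm.principal (aeval n f))}

/-! The inequality holds because its left side is zero, while each product on the right is a limit
of nonnegative numbers.

If `n` is a trivial specialization, some unit multiple `u A(n)` has the form `x² - f(n) y²`. Only
the class of `u` modulo squares matters, and there are finitely many classes, so a single `u` can be
fixed. Some root `ρ` makes `d = u A(ρ)` a nonsquare in `F = K(ρ)`; otherwise the Chinese remainder
theorem would make `u A` a square modulo `f`, and the form would lie in the principal genus. Let `v`
be a prime of `F` of degree one, inert in `F(√d)`, prime to `2`, `d` and `S`. A congruence `n ≡ ρ`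
modulo `v` would give `f(n) ≡ 0` and `d ≡ x²`, against inertness. Hence `n` avoids one residue class
modulo the prime below `v`, and finitely many such primes bound the density by `∏ (1 - 1/N(v))`.

These products get arbitrarily small because `∑ 1/N(v)` diverges (`not_summable_inert`). If it
converged, then outside a set of primes with convergent sum every prime of `F` would have two primes
of the same norm above it in `F' = F(√d)`. Euler products would give `ζ_F(s)² ≤ c ζ_{F'}(s)` for `s
> 1`, against the simple poles at `s = 1`. -/

/-! ### Euler products over finite sets of primes. -/

section EulerProduct

open scoped ENNReal

variable {R : Type*} [CommRing R] [IsDedekindDomain R]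

/-- The nonzero ideals all of whose prime divisors lie in `T`. -/
def idealsFactoredOver (T : Set (HeightOneSpectrum R)) : Set (Ideal R) :=
  {I | I ≠ ⊥ ∧ ∀ v : HeightOneSpectrum R, v.asIdeal ∣ I → v ∈ T}

theorem idealsFactoredOver_empty : idealsFactoredOver (∅ : Set (HeightOneSpectrum R)) = {1} := by
  ext I
  constructor
  · rintro ⟨h0, h⟩
    by_contra hI
    obtain ⟨M, hM, hIM⟩ := Ideal.exists_le_maximal I (by simpa using hI)
    exact h ⟨M, hM.isPrime, fun hb => h0 (le_bot_iff.mp (hb ▸ hIM))⟩ (Ideal.dvd_iff_le.mpr hIM)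
  · rintro rfl
    exact ⟨one_ne_zero, fun v hv => (v.prime.not_isUnit (isUnit_of_dvd_one hv)).elim⟩

theorem HeightOneSpectrum.eq_of_dvd_asIdeal {v w : HeightOneSpectrum R}
    (h : v.asIdeal ∣ w.asIdeal) : v = w :=
  HeightOneSpectrum.ext (associated_iff_eq.mp ((v.prime.dvd_prime_iff_associated w.prime).mp h))

/-- Unique factorization: splitting off the exact power of `v` is the induction step of the Euler
product. -/
theorem bijective_pow_mul_idealsFactoredOver (T : Set (HeightOneSpectrum R))
    (v : HeightOneSpectrum R) (hv : v ∉ T) :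
    Function.Bijective (fun p : ℕ × idealsFactoredOver T =>
      (⟨v.asIdeal ^ p.1 * p.2.1, mul_ne_zero (pow_ne_zero _ v.ne_bot) p.2.2.1, fun w hw => by
        rcases w.prime.dvd_or_dvd hw with h | h
        · exact Or.inl (HeightOneSpectrum.eq_of_dvd_asIdeal (w.prime.dvd_of_dvd_pow h))
        · exact Or.inr (p.2.2.2 w h)⟩ : idealsFactoredOver (insert v T))) := by
  constructor
  · have key : ∀ (k l : ℕ) (I J : Ideal R), ¬ v.asIdeal ∣ J →
        v.asIdeal ^ k * I = v.asIdeal ^ l * J → k ≤ l := by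
      intro k l I J hJ h
      by_contra! hkl
      obtain ⟨m, rfl⟩ := Nat.exists_eq_add_of_lt hkl
      rw [add_assoc, pow_add, mul_assoc] at h
      have := mul_left_cancel₀ (pow_ne_zero l v.ne_bot) h
      exact hJ ⟨v.asIdeal ^ m * I, by rw [← this, pow_succ']; ring⟩
    rintro ⟨k, I, hI⟩ ⟨l, J, hJ⟩ h
    have h' : v.asIdeal ^ k * I = v.asIdeal ^ l * J := congrArg Subtype.val h
    have hkl : k = l := le_antisymm (key k l I J (fun h => hv (hJ.2 v h)) h')
      (key l k J I (fun h => hv (hI.2 v h)) h'.symm)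
    subst hkl
    have := mul_left_cancel₀ (pow_ne_zero k v.ne_bot) h'
    subst this
    rfl
  · rintro ⟨I, h0, hI⟩
    obtain ⟨J, hIJ, hJ⟩ :=
      (FiniteMultiplicity.of_prime_left v.prime h0).exists_eq_pow_mul_and_not_dvd
    have hJ0 : J ≠ ⊥ := by
      rintro rfl
      exact hJ (dvd_zero _)
    refine ⟨⟨multiplicity v.asIdeal I, J, hJ0, fun w hw => ?_⟩, Subtype.ext hIJ.symm⟩
    rcases hI w (hIJ ▸ Dvd.dvd.mul_left hw _) with rfl | h
    · exact (hJ hw).elim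
    · exact h

/-- The Euler product over a finite set of primes. -/
theorem tsum_idealsFactoredOver (w : Ideal R →* ℝ≥0∞) (T : Finset (HeightOneSpectrum R)) :
    ∑' I : idealsFactoredOver (T : Set (HeightOneSpectrum R)), w I =
      ∏ v ∈ T, (1 - w v.asIdeal)⁻¹ := by
  classical
  induction T using Finset.induction with
  | empty =>
    rw [Finset.coe_empty, idealsFactoredOver_empty]
    simp [-Ideal.one_eq_top]
  | insert v T hv ih =>
    rw [Finset.prod_insert hv, ← ih, Finset.coe_insert, ← ENNReal.tsum_geometric,
      ← ENNReal.tsum_mul_right,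
      ← (Equiv.ofBijective _ (bijective_pow_mul_idealsFactoredOver T v (by simpa using hv))).tsum_eq,
      ENNReal.tsum_prod']
    simp [ENNReal.tsum_mul_left]

theorem prod_inv_le_tsum (w : Ideal R →* ℝ≥0∞) (T : Finset (HeightOneSpectrum R)) :
    ∏ v ∈ T, (1 - w v.asIdeal)⁻¹ ≤ ∑' I : {I : Ideal R // I ≠ ⊥}, w I := by
  rw [← tsum_idealsFactoredOver]
  exact ENNReal.tsum_comp_le_tsum_of_injective
    (f := fun I : idealsFactoredOver (T : Set (HeightOneSpectrum R)) =>
      (⟨I.1, I.2.1⟩ : {I : Ideal R // I ≠ ⊥}))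
    (fun I J h => Subtype.ext (congrArg Subtype.val h :)) (fun I => w I.1)

/-- Finitely many nonzero ideals involve only finitely many primes, so each partial sum is part of
one finite Euler product. -/
theorem tsum_le_of_prod_inv_le (w : Ideal R →* ℝ≥0∞) (c : ℝ≥0∞)
    (h : ∀ T : Finset (HeightOneSpectrum R), ∏ v ∈ T, (1 - w v.asIdeal)⁻¹ ≤ c) :
    ∑' I : {I : Ideal R // I ≠ ⊥}, w I ≤ c := by
  classical
  rw [ENNReal.tsum_eq_iSup_sum]
  refine iSup_le fun s => ?_
  have hfin : (⋃ I ∈ s, {v : HeightOneSpectrum R | v.asIdeal ∣ I.1}).Finite :=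
    s.finite_toSet.biUnion fun I _ => Ideal.finite_factors I.2
  refine le_trans ?_ (h hfin.toFinset)
  rw [← tsum_idealsFactoredOver]
  have hmem : ∀ I ∈ s, I.1 ∈ idealsFactoredOver (hfin.toFinset : Set (HeightOneSpectrum R)) :=
    fun I hI => ⟨I.2, fun v hv => by simpa using ⟨I.1, ⟨I.2, hI⟩, hv⟩⟩
  calc ∑ I ∈ s, w I = ∑ I : s, w I.1 := (Finset.sum_coe_sort s (fun I => w I.1)).symm
    _ = ∑' I : s, w I.1 := (tsum_fintype _).symm
    _ ≤ _ := ENNReal.tsum_comp_le_tsum_of_injective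
      (f := fun I : s => (⟨I.1.1, hmem I.1 I.2⟩ : idealsFactoredOver
        (hfin.toFinset : Set (HeightOneSpectrum R))))
      (fun I J h => Subtype.ext (Subtype.ext (congrArg Subtype.val h :))) (fun I => w I.1)

end EulerProduct

/-! ### Dedekind zeta functions near `s = 1`. -/

section Zeta

open scoped ENNReal Topology
open Filter

/-- The weight `I ↦ N(I)⁻ˢ`. -/
noncomputable def normWeight (F : Type*) [Field F] [NumberField F] (s : ℝ) :
    Ideal (𝓞 F) →* ℝ≥0∞ where
  toFun I := ENNReal.ofReal ((Ideal.absNorm I : ℝ) ^ (-s))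
  map_one' := by simp
  map_mul' I J := by
    rw [← ENNReal.ofReal_mul (by positivity), map_mul, Nat.cast_mul,
      Real.mul_rpow (by positivity) (by positivity)]

variable (F : Type*) [Field F] [NumberField F]

/-- The number of ideals of norm at most `n` grows linearly, so the partial sums of the coefficients
are `O(n)`. -/
theorem LSeriesSummable_card_absNorm_eq {s : ℝ} (hs : 1 < s) :
    LSeriesSummable (fun n ↦ (Nat.card {I : Ideal (𝓞 F) // Ideal.absNorm I = n} : ℂ)) s := by
  have hlim : Tendsto (fun n : ℕ ↦ (∑ k ∈ Finset.Icc 1 n,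
      (Nat.card {I : Ideal (𝓞 F) // Ideal.absNorm I = k} : ℝ)) / (n : ℝ)) atTop
      (𝓝 (dedekindZeta_residue F)) := by
    refine ((Ideal.tendsto_norm_le_div_atTop₀ F).comp tendsto_natCast_atTop_atTop).congr fun n ↦ ?_
    simp only [Function.comp_apply, Nat.cast_le, ← Nat.cast_sum]
    congr
    -- The limit theorem counts nonzero ideals only; the added `1` is the zero ideal, the only one
    -- of norm `0`.
    rw [← add_left_inj 1, ← Ideal.card_norm_le_eq_card_norm_le_add_one,
      show Finset.Icc 1 n = Finset.Ioc 0 n from Finset.Icc_succ_left_eq_Ioc _ _,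
      show 1 = Nat.card {I : Ideal (𝓞 F) // Ideal.absNorm I = 0} by
        simp [Ideal.absNorm_eq_zero_iff],
      Finset.sum_Ioc_add_eq_sum_Icc (n.zero_le),
      ← Finset.card_preimage_eq_sum_card_image_eq
        (fun k _ ↦ Ideal.finite_setOfPred_absNorm_eq k)]
    simp [Set.coe_eq_subtype]
  have := LSeriesSummable_of_sum_norm_bigO_and_nonneg (r := 1) (s := s)
    (f := fun n => (Nat.card {I : Ideal (𝓞 F) // Ideal.absNorm I = n} : ℝ))
    (Asymptotics.isBigO_atTop_natCast_rpow_of_tendsto_div_rpow (by simpa using hlim))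
    (fun _ => by positivity) zero_le_one (by simpa using hs)
  simpa using this

theorem tsum_normWeight {s : ℝ} (hs : 1 < s) :
    ∑' I : {I : Ideal (𝓞 F) // I ≠ ⊥}, normWeight F s I =
      ENNReal.ofReal (dedekindZeta F s).re := by
  have hterm : ∀ n : ℕ,
      LSeries.term (fun n ↦ (Nat.card {I : Ideal (𝓞 F) // Ideal.absNorm I = n} : ℂ)) s n =
      (((if n = 0 then 0 else (Nat.card {I : Ideal (𝓞 F) // Ideal.absNorm I = n} : ℝ) *
        (n : ℝ) ^ (-s) : ℝ)) : ℂ) := by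
    intro n
    rw [LSeries.term_def]
    split_ifs with h
    · simp
    · rw [Real.rpow_neg (by positivity)]
      push_cast [Complex.ofReal_cpow (show (0:ℝ) ≤ n by positivity)]
      rw [div_eq_mul_inv]
  have hsum := LSeriesSummable_card_absNorm_eq F hs
  rw [LSeriesSummable, funext hterm] at hsum
  have hsum' := Complex.summable_ofReal.mp hsum
  have hz : (dedekindZeta F s).re = ∑' n : ℕ, (if n = 0 then 0 else
      (Nat.card {I : Ideal (𝓞 F) // Ideal.absNorm I = n} : ℝ) * (n : ℝ) ^ (-s) : ℝ) := by
    rw [dedekindZeta, LSeries, funext hterm, ← Complex.ofReal_tsum, Complex.ofReal_re]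
  rw [hz, ENNReal.ofReal_tsum_of_nonneg (fun n => by positivity) hsum',
    ← (Equiv.sigmaFiberEquiv
      (fun I : {I : Ideal (𝓞 F) // I ≠ ⊥} => Ideal.absNorm I.1)).tsum_eq, ENNReal.tsum_sigma']
  refine tsum_congr fun n => ?_
  rcases Nat.eq_zero_or_pos n with rfl | hn
  · have : IsEmpty {I : {I : Ideal (𝓞 F) // I ≠ ⊥} // Ideal.absNorm I.1 = 0} :=
      ⟨fun I => I.1.2 (Ideal.absNorm_eq_zero_iff.mp I.2)⟩
    simp
  · have hfin : Finite {I : Ideal (𝓞 F) // Ideal.absNorm I = n} :=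
      Ideal.finite_setOfPred_absNorm_eq n
    let e : {I : {I : Ideal (𝓞 F) // I ≠ ⊥} // Ideal.absNorm I.1 = n} ≃
        {I : Ideal (𝓞 F) // Ideal.absNorm I = n} :=
      { toFun := fun I => ⟨I.1.1, I.2⟩
        invFun := fun I => ⟨⟨I.1, fun h => by
          have := I.2
          rw [h, Ideal.absNorm_bot] at this
          omega⟩, I.2⟩
        left_inv := fun _ => rfl
        right_inv := fun _ => rfl }
    rw [← e.symm.tsum_eq, if_neg hn.ne']
    have : ∀ I : {I : Ideal (𝓞 F) // Ideal.absNorm I = n},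
        normWeight F s ((Equiv.sigmaFiberEquiv
          (fun I : {I : Ideal (𝓞 F) // I ≠ ⊥} => Ideal.absNorm I.1)) ⟨n, e.symm I⟩).1 =
        ENNReal.ofReal ((n : ℝ) ^ (-s)) := by
      rintro ⟨I, rfl⟩
      rfl
    have := Fintype.ofFinite {I : Ideal (𝓞 F) // Ideal.absNorm I = n}
    rw [tsum_congr (by assumption), tsum_fintype, Finset.sum_const, Finset.card_univ,
      ← Nat.card_eq_fintype_card, nsmul_eq_mul, ENNReal.ofReal_mul (by positivity),
      ENNReal.ofReal_natCast]

theorem tendsto_sub_one_mul_dedekindZeta_re :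
    Tendsto (fun s : ℝ ↦ (s - 1) * (dedekindZeta F s).re) (𝓝[>] 1)
      (𝓝 (dedekindZeta_residue F)) := by
  have := (Complex.continuous_re.tendsto _).comp (tendsto_sub_one_mul_dedekindZeta_nhdsGT F)
  refine this.congr fun s => ?_
  rw [Function.comp_apply, ← Complex.ofReal_one, ← Complex.ofReal_sub, Complex.re_ofReal_mul]

theorem two_le_absNorm {F : Type*} [Field F] [NumberField F] (v : HeightOneSpectrum (𝓞 F)) :
    2 ≤ Ideal.absNorm v.asIdeal := by
  have h0 : Ideal.absNorm v.asIdeal ≠ 0 := fun h => v.ne_bot (Ideal.absNorm_eq_zero_iff.mp h)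
  have h1 : Ideal.absNorm v.asIdeal ≠ 1 := fun h =>
    v.isPrime.ne_top (Ideal.absNorm_eq_one_iff.mp h)
  omega

/-- For `0 ≤ x ≤ 1/2` one has `(1 - x)(1 + 2x) ≥ 1`, hence `(1 - x)⁻¹ ≤ exp(2x)`. What matters is
that the bound does not depend on `s`. -/
theorem inv_one_sub_normWeight_le {F : Type*} [Field F] [NumberField F] {s : ℝ} (hs : 1 < s)
    (v : HeightOneSpectrum (𝓞 F)) :
    (1 - normWeight F s v.asIdeal)⁻¹ ≤
      ENNReal.ofReal (Real.exp (2 * (1 / (Ideal.absNorm v.asIdeal : ℝ)))) := by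
  have hN : (2 : ℝ) ≤ Ideal.absNorm v.asIdeal := by exact_mod_cast two_le_absNorm v
  set N : ℝ := ((Ideal.absNorm v.asIdeal : ℕ) : ℝ) with hNdef
  have hx : 1 / N ≤ 1 / 2 := one_div_le_one_div_of_le (by norm_num) hN
  have hx0 : 0 ≤ 1 / N := by positivity
  set x : ℝ := 1 / N with hxdef
  have hw : normWeight F s v.asIdeal ≤ ENNReal.ofReal x := by
    refine ENNReal.ofReal_le_ofReal ?_
    rw [hxdef, one_div, ← Real.rpow_neg_one]
    exact Real.rpow_le_rpow_of_exponent_le (by linarith) (by linarith)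
  calc (1 - normWeight F s v.asIdeal)⁻¹ ≤ (1 - ENNReal.ofReal x)⁻¹ :=
        ENNReal.inv_le_inv.mpr (tsub_le_tsub_left hw 1)
    _ = ENNReal.ofReal (1 - x)⁻¹ := by
        rw [ENNReal.ofReal_inv_of_pos (by linarith), ENNReal.ofReal_sub _ hx0, ENNReal.ofReal_one]
    _ ≤ _ := by
        refine ENNReal.ofReal_le_ofReal (inv_le_of_inv_le₀ (Real.exp_pos _) ?_)
        rw [inv_le_iff_one_le_mul₀ (Real.exp_pos _)]
        nlinarith [Real.add_one_le_exp (2 * x)]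

/-- If all primes of `F` outside `D` have two distinct primes of the same norm above them in `F'`,
then `∑ 1 / N(v)` over `D` diverges. -/
theorem not_summable_of_two_primes {F F' : Type*} [Field F] [NumberField F] [Field F']
    [NumberField F'] (D : Set (HeightOneSpectrum (𝓞 F)))
    (u : HeightOneSpectrum (𝓞 F') → HeightOneSpectrum (𝓞 F))
    (p q : HeightOneSpectrum (𝓞 F) → HeightOneSpectrum (𝓞 F'))
    (hp : ∀ v ∉ D, u (p v) = v) (hq : ∀ v ∉ D, u (q v) = v) (hpq : ∀ v ∉ D, p v ≠ q v)
    (hNp : ∀ v ∉ D, Ideal.absNorm (p v).asIdeal = Ideal.absNorm v.asIdeal)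
    (hNq : ∀ v ∉ D, Ideal.absNorm (q v).asIdeal = Ideal.absNorm v.asIdeal) :
    ¬ Summable fun v : D => 1 / (Ideal.absNorm v.1.asIdeal : ℝ) := by
  classical
  intro hsum
  set M : ℝ := ∑' v : D, 1 / (Ideal.absNorm v.1.asIdeal : ℝ)
  have hin : ∀ s : ℝ, 1 < s → ∀ T : Finset (HeightOneSpectrum (𝓞 F)),
      ∏ v ∈ T with v ∈ D, (1 - normWeight F s v.asIdeal)⁻¹ ≤
        ENNReal.ofReal (Real.exp (2 * M)) := by
    intro s hs T
    refine (Finset.prod_le_prod' fun v _ => inv_one_sub_normWeight_le hs v).trans ?_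
    rw [← ENNReal.ofReal_prod_of_nonneg (fun _ _ => (Real.exp_pos _).le), ← Real.exp_sum,
      ← Finset.mul_sum]
    refine ENNReal.ofReal_le_ofReal (Real.exp_le_exp.mpr (mul_le_mul_of_nonneg_left ?_ zero_le_two))
    rw [← Finset.sum_subtype_eq_sum_filter]
    exact hsum.sum_le_tsum _ (fun _ _ => by positivity)
  -- Since `u` recovers `v` from `p v` and from `q v`, the two images are disjoint and `p`, `q` are
  -- injective there; each Euler factor of `v` thus occurs twice in the product for `F'`.
  have hout : ∀ s : ℝ, 1 < s → ∀ T : Finset (HeightOneSpectrum (𝓞 F)),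
      (∏ v ∈ T with v ∉ D, (1 - normWeight F s v.asIdeal)⁻¹) ^ 2 ≤
        ENNReal.ofReal (dedekindZeta F' s).re := by
    intro s hs T
    set T₀ := T.filter (· ∉ D) with hT₀
    have hT : ∀ v ∈ T₀, v ∉ D := fun v hv => (Finset.mem_filter.mp hv).2
    have hdis : Disjoint (T₀.image p) (T₀.image q) := by
      rw [Finset.disjoint_left]
      intro w hw hw'
      obtain ⟨v, hv, rfl⟩ := Finset.mem_image.mp hw
      obtain ⟨v', hv', h⟩ := Finset.mem_image.mp hw'
      have : v' = v := by rw [← hq v' (hT v' hv'), h, hp v (hT v hv)]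
      subst this
      exact hpq v' (hT v' hv') h.symm
    rw [← tsum_normWeight F' hs]
    refine le_trans (le_of_eq ?_) (prod_inv_le_tsum (normWeight F' s) (T₀.image p ∪ T₀.image q))
    rw [Finset.prod_union hdis, Finset.prod_image, Finset.prod_image, sq]
    · congr 1 <;> refine Finset.prod_congr rfl fun v hv => ?_
      · simp [normWeight, hNp v (hT v hv)]
      · simp [normWeight, hNq v (hT v hv)]
    · intro v hv v' hv' h
      rw [← hq v (hT v hv), ← hq v' (hT v' hv'), h]
    · intro v hv v' hv' h
      rw [← hp v (hT v hv), ← hp v' (hT v' hv'), h]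
  have hmain : ∀ s : ℝ, 1 < s → ENNReal.ofReal (dedekindZeta F s).re ^ 2 ≤
      ENNReal.ofReal (Real.exp (2 * M)) ^ 2 * ENNReal.ofReal (dedekindZeta F' s).re := by
    intro s hs
    have : ENNReal.ofReal (dedekindZeta F s).re ≤ (ENNReal.ofReal (Real.exp (2 * M)) ^ 2 *
        ENNReal.ofReal (dedekindZeta F' s).re) ^ (1 / 2 : ℝ) := by
      rw [← tsum_normWeight F hs]
      refine tsum_le_of_prod_inv_le _ _ fun T => ?_
      rw [← ENNReal.rpow_le_rpow_iff (show (0 : ℝ) < 2 by norm_num), ← ENNReal.rpow_mul]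
      norm_num
      rw [← Finset.prod_filter_mul_prod_filter_not T (· ∈ D), mul_pow]
      exact mul_le_mul' (pow_le_pow_left' (hin s hs T) 2) (hout s hs T)
    have h2 := ENNReal.rpow_le_rpow this (show (0 : ℝ) ≤ 2 by norm_num)
    rw [← ENNReal.rpow_mul] at h2
    norm_num at h2
    exact h2
  -- After multiplying `hmain` by `(s - 1)²`, the left side tends to the squared residue of `ζ_F`,
  -- while the right side keeps a spare factor `s - 1` and tends to `0`.
  have hlim1 : Tendsto (fun s : ℝ => ENNReal.ofReal ((s - 1) * (dedekindZeta F s).re) ^ 2) (𝓝[>] 1)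
      (𝓝 (ENNReal.ofReal (dedekindZeta_residue F) ^ 2)) :=
    ((ENNReal.continuous_pow 2).tendsto _).comp
      (ENNReal.tendsto_ofReal (tendsto_sub_one_mul_dedekindZeta_re F))
  have hlim2 : Tendsto (fun s : ℝ => ENNReal.ofReal ((Real.exp (2 * M)) ^ 2 *
      ((s - 1) * ((s - 1) * (dedekindZeta F' s).re)))) (𝓝[>] 1) (𝓝 0) := by
    have h0 : Tendsto (fun s : ℝ => s - 1) (𝓝[>] 1) (𝓝 0) :=
      tendsto_nhdsWithin_of_tendsto_nhds
        (by simpa using (continuous_sub_right (1 : ℝ)).tendsto 1)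
    have := ENNReal.tendsto_ofReal
      ((h0.mul (tendsto_sub_one_mul_dedekindZeta_re F')).const_mul ((Real.exp (2 * M)) ^ 2))
    simpa using this
  have hle := le_of_tendsto_of_tendsto hlim1 hlim2 (by
    filter_upwards [self_mem_nhdsWithin] with s hs
    have hs1 : (0 : ℝ) ≤ s - 1 := by
      have : (1 : ℝ) < s := hs
      linarith
    rw [ENNReal.ofReal_mul hs1, ENNReal.ofReal_mul (by positivity), ENNReal.ofReal_mul hs1,
      ENNReal.ofReal_mul hs1, ENNReal.ofReal_pow (by positivity), mul_pow, sq (ENNReal.ofReal (s - 1))]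
    calc _ ≤ ENNReal.ofReal (s - 1) * ENNReal.ofReal (s - 1) * _ :=
          mul_le_mul_right (hmain s hs) _
      _ = _ := by ring)
  have := dedekindZeta_residue_pos F
  rw [nonpos_iff_eq_zero, pow_eq_zero_iff two_ne_zero, ENNReal.ofReal_eq_zero] at hle
  linarith

/-- `∑ 1 / N(v)²` over the primes of a number field converges. -/
theorem summable_one_div_absNorm_sq (F : Type*) [Field F] [NumberField F] :
    Summable fun v : HeightOneSpectrum (𝓞 F) => 1 / (Ideal.absNorm v.asIdeal : ℝ) ^ 2 := by
  have h := tsum_normWeight F (s := 2) one_lt_two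
  have hne : ∑' v : HeightOneSpectrum (𝓞 F),
      ENNReal.ofReal (1 / (Ideal.absNorm v.asIdeal : ℝ) ^ 2) ≠ ⊤ := by
    refine ne_top_of_le_ne_top (h ▸ ENNReal.ofReal_ne_top) ?_
    refine le_trans (le_of_eq (tsum_congr fun v => ?_)) (ENNReal.tsum_comp_le_tsum_of_injective
      (f := fun v : HeightOneSpectrum (𝓞 F) => (⟨v.asIdeal, v.ne_bot⟩ : {I : Ideal (𝓞 F) // I ≠ ⊥}))
      (fun v w h => HeightOneSpectrum.ext (congrArg Subtype.val h :))
      (fun I => normWeight F 2 I))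
    simp [normWeight]
  refine (ENNReal.summable_toReal hne).congr fun v => ENNReal.toReal_ofReal (by positivity)

end Zeta

/-! ### Splitting of primes and divergence over inert primes. -/

section QuadraticExtension

variable {F F' : Type*} [Field F] [NumberField F] [Field F'] [NumberField F'] [Algebra F F']

theorem sum_ramificationIdx_mul_inertiaDeg (v : HeightOneSpectrum (𝓞 F)) :
    ∑ q : v.asIdeal.primesOver (𝓞 F'), q.1.ramificationIdx (𝓞 F) * q.1.inertiaDeg (𝓞 F) =
      Module.finrank F F' := by
  rw [Ideal.sum_ramification_inertia_eq_finrank, IsFractionRing.finrank_eq (𝓞 F) F (𝓞 F') F']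

theorem card_primesOver_le_finrank (v : HeightOneSpectrum (𝓞 F)) :
    Fintype.card (v.asIdeal.primesOver (𝓞 F')) ≤ Module.finrank F F' := by
  rw [← sum_ramificationIdx_mul_inertiaDeg v, ← Finset.card_univ, Finset.card_eq_sum_ones]
  refine Finset.sum_le_sum fun q _ => ?_
  have := q.2.1
  exact Nat.mul_pos (q.1.ramificationIdx_pos (𝓞 F)) (q.1.inertiaDeg_pos (𝓞 F))

omit [NumberField F] [NumberField F'] in
theorem HeightOneSpectrum.under_eq_iff {v : HeightOneSpectrum (𝓞 F)}
    {w : HeightOneSpectrum (𝓞 F')} :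
    w.under (𝓞 F) = v ↔ w.asIdeal.LiesOver v.asIdeal := by
  rw [Ideal.liesOver_iff, HeightOneSpectrum.ext_iff, HeightOneSpectrum.under_asIdeal, eq_comm]

/-- At most `[F' : F]` primes lie above each `v`, so the pulled-back series grows by at most that
factor. -/
theorem summable_comp_under {g : HeightOneSpectrum (𝓞 F) → ℝ} (hg : ∀ v, 0 ≤ g v)
    (h : Summable g) : Summable fun w : HeightOneSpectrum (𝓞 F') => g (w.under (𝓞 F)) := by
  have hne : ∑' w : HeightOneSpectrum (𝓞 F'), ENNReal.ofReal (g (w.under (𝓞 F))) ≠ ⊤ := by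
    refine ne_top_of_le_ne_top (ENNReal.mul_ne_top
      (ENNReal.natCast_ne_top (Module.finrank F F')) h.tsum_ofReal_ne_top) ?_
    rw [← (Equiv.sigmaFiberEquiv
      (fun w : HeightOneSpectrum (𝓞 F') => w.under (𝓞 F))).tsum_eq, ENNReal.tsum_sigma',
      ← ENNReal.tsum_mul_left]
    refine ENNReal.tsum_le_tsum fun v => ?_
    let i : {w : HeightOneSpectrum (𝓞 F') // w.under (𝓞 F) = v} →
        v.asIdeal.primesOver (𝓞 F') :=
      fun w => ⟨w.1.asIdeal, w.1.isPrime, HeightOneSpectrum.under_eq_iff.mp w.2⟩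
    have hi : Function.Injective i := fun w w' hww =>
      Subtype.ext (HeightOneSpectrum.ext (congrArg Subtype.val hww :))
    have := Fintype.ofInjective i hi
    have hc : ∀ w : {w : HeightOneSpectrum (𝓞 F') // w.under (𝓞 F) = v},
        ENNReal.ofReal (g (HeightOneSpectrum.under (𝓞 F) (Equiv.sigmaFiberEquiv
          (fun w : HeightOneSpectrum (𝓞 F') => w.under (𝓞 F)) ⟨v, w⟩))) =
        ENNReal.ofReal (g v) := by
      rintro ⟨w, rfl⟩
      rfl
    rw [tsum_congr hc, tsum_fintype, Finset.sum_const, Finset.card_univ, nsmul_eq_mul]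
    gcongr
    exact (Fintype.card_le_of_injective i hi).trans (card_primesOver_le_finrank v)
  exact (ENNReal.summable_toReal hne).congr fun v => ENNReal.toReal_ofReal (hg _)

/-- With all `e = 1`, a single prime above `v` would be the extension of `v` itself. So there are
two, and `∑ e f = 2` forces `f = 1` for both. -/
theorem exists_two_primes_of_unramified (hdeg : Module.finrank F F' = 2)
    (v : HeightOneSpectrum (𝓞 F))
    (hunr : ∀ w : Ideal (𝓞 F'), w.IsPrime → w.LiesOver v.asIdeal → w.ramificationIdx (𝓞 F) = 1)
    (hv : ¬ (v.asIdeal.map (algebraMap (𝓞 F) (𝓞 F'))).IsPrime) :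
    ∃ w₁ w₂ : HeightOneSpectrum (𝓞 F'), w₁ ≠ w₂ ∧ w₁.under (𝓞 F) = v ∧ w₂.under (𝓞 F) = v ∧
      Ideal.absNorm w₁.asIdeal = Ideal.absNorm v.asIdeal ∧
      Ideal.absNorm w₂.asIdeal = Ideal.absNorm v.asIdeal := by
  classical
  have hsum := sum_ramificationIdx_mul_inertiaDeg (F' := F') v
  rw [hdeg] at hsum
  obtain ⟨P, hP⟩ : Nonempty (v.asIdeal.primesOver (𝓞 F')) := inferInstance
  have hsub : ¬ ∀ Q ∈ v.asIdeal.primesOver (𝓞 F'), Q = P := by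
    intro hall
    apply hv
    have hset : v.asIdeal.primesOver (𝓞 F') = {P} := by
      ext Q
      exact ⟨fun hQ => hall Q hQ, fun hQ => hQ ▸ hP⟩
    have hmap := Ideal.map_algebraMap_eq_finsetProd_pow (R := 𝓞 F') (p := v.asIdeal) v.ne_bot
    rw [hmap]
    have : (v.asIdeal.primesOver (𝓞 F')).toFinset = {P} := by
      ext Q
      simp [hset]
    rw [this, Finset.prod_singleton, hunr P hP.1 hP.2, pow_one]
    exact hP.1
  push Not at hsub
  obtain ⟨Q, hQ, hQP⟩ := hsub
  have hpos : ∀ q : v.asIdeal.primesOver (𝓞 F'),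
      0 < q.1.ramificationIdx (𝓞 F) * q.1.inertiaDeg (𝓞 F) := fun q => by
    have := q.2.1
    exact Nat.mul_pos (q.1.ramificationIdx_pos (𝓞 F)) (q.1.inertiaDeg_pos (𝓞 F))
  have hle := Finset.sum_le_sum_of_subset
    (f := fun q : v.asIdeal.primesOver (𝓞 F') =>
      q.1.ramificationIdx (𝓞 F) * q.1.inertiaDeg (𝓞 F))
    (Finset.subset_univ {(⟨Q, hQ⟩ : v.asIdeal.primesOver (𝓞 F')), ⟨P, hP⟩})
  rw [Finset.sum_pair (by simpa using hQP), hsum, hunr P hP.1 hP.2, hunr Q hQ.1 hQ.2] at hle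
  have h1 := hpos ⟨P, hP⟩
  have h2 := hpos ⟨Q, hQ⟩
  simp only [hunr P hP.1 hP.2, hunr Q hQ.1 hQ.2] at h1 h2 hle
  have hfP : P.inertiaDeg (𝓞 F) = 1 := by omega
  have hfQ : Q.inertiaDeg (𝓞 F) = 1 := by omega
  have := hP.1
  have := hP.2
  have := hQ.1
  have := hQ.2
  have hNP := Ideal.absNorm_pow_inertiaDeg v.asIdeal P
  have hNQ := Ideal.absNorm_pow_inertiaDeg v.asIdeal Q
  rw [hfP, pow_one] at hNP
  rw [hfQ, pow_one] at hNQ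
  exact ⟨⟨P, hP.1, Ideal.ne_bot_of_liesOver_of_ne_bot v.ne_bot P⟩,
    ⟨Q, hQ.1, Ideal.ne_bot_of_liesOver_of_ne_bot v.ne_bot Q⟩,
    fun h => hQP (congrArg HeightOneSpectrum.asIdeal h).symm,
    HeightOneSpectrum.under_eq_iff.mpr hP.2, HeightOneSpectrum.under_eq_iff.mpr hQ.2,
    hNP.symm, hNQ.symm⟩

variable (F F') in
-- Ramified primes divide the different, which is nonzero.
theorem finite_ramified_primes : {v : HeightOneSpectrum (𝓞 F) | ∃ w : Ideal (𝓞 F'), w.IsPrime ∧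
    w.LiesOver v.asIdeal ∧ w.ramificationIdx (𝓞 F) ≠ 1}.Finite := by
  have h0 : differentIdeal (𝓞 F) (𝓞 F') ≠ ⊥ := differentIdeal_ne_bot
  refine ((Ideal.finite_factors h0).image (fun w => w.under (𝓞 F))).subset ?_
  rintro v ⟨w, hw, hwv, hram⟩
  have hw0 : w ≠ ⊥ := Ideal.ne_bot_of_liesOver_of_ne_bot v.ne_bot w
  refine ⟨⟨w, hw, hw0⟩, ?_, HeightOneSpectrum.under_eq_iff.mpr hwv⟩
  rw [Set.mem_ofPred_eq]
  by_contra hdvd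
  exact hram (Ideal.ramificationIdx_eq_one_iff.mpr (not_dvd_differentIdeal_iff.mp hdvd))

/-- In a quadratic extension `F'/F`, the primes of `F` that are inert in `F'` and of degree one
over a subfield `K` are so many that the sum of the inverses of their norms diverges. -/
theorem not_summable_inert (K : Type*) [Field K] [NumberField K] [Algebra K F]
    (hdeg : Module.finrank F F' = 2) :
    ¬ Summable ({v : HeightOneSpectrum (𝓞 F) | v.asIdeal.inertiaDeg (𝓞 K) = 1 ∧
      (v.asIdeal.map (algebraMap (𝓞 F) (𝓞 F'))).IsPrime}.indicator
        fun v => 1 / (Ideal.absNorm v.asIdeal : ℝ)) := by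
  classical
  intro hsum
  set D : Set (HeightOneSpectrum (𝓞 F)) := {v | ¬ ∃ w₁ w₂ : HeightOneSpectrum (𝓞 F'), w₁ ≠ w₂ ∧
    w₁.under (𝓞 F) = v ∧ w₂.under (𝓞 F) = v ∧ Ideal.absNorm w₁.asIdeal = Ideal.absNorm v.asIdeal ∧
      Ideal.absNorm w₂.asIdeal = Ideal.absNorm v.asIdeal} with hD
  have hex : ∀ v, ∃ w : HeightOneSpectrum (𝓞 F') × HeightOneSpectrum (𝓞 F'), v ∉ D →
      w.1 ≠ w.2 ∧ w.1.under (𝓞 F) = v ∧ w.2.under (𝓞 F) = v ∧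
      Ideal.absNorm w.1.asIdeal = Ideal.absNorm v.asIdeal ∧
      Ideal.absNorm w.2.asIdeal = Ideal.absNorm v.asIdeal := by
    intro v
    by_cases hv : v ∈ D
    · obtain ⟨P, hP⟩ : Nonempty (v.asIdeal.primesOver (𝓞 F')) := inferInstance
      have := hP.2
      have w : HeightOneSpectrum (𝓞 F') :=
        ⟨P, hP.1, Ideal.ne_bot_of_liesOver_of_ne_bot v.ne_bot P⟩
      exact ⟨(w, w), fun h => (h hv).elim⟩
    · obtain ⟨w₁, w₂, h⟩ := not_not.mp hv
      exact ⟨(w₁, w₂), fun _ => h⟩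
  choose w hw using hex
  refine not_summable_of_two_primes D (fun x => x.under (𝓞 F)) (fun v => (w v).1)
    (fun v => (w v).2) (fun v hv => (hw v hv).2.1) (fun v hv => (hw v hv).2.2.1)
    (fun v hv => (hw v hv).1) (fun v hv => (hw v hv).2.2.2.1) (fun v hv => (hw v hv).2.2.2.2) ?_
  have hram := finite_ramified_primes F F'
  set Ram := {v : HeightOneSpectrum (𝓞 F) | ∃ w : Ideal (𝓞 F'), w.IsPrime ∧
    w.LiesOver v.asIdeal ∧ w.ramificationIdx (𝓞 F) ≠ 1}
  have h2 : Summable (Ram.indicator fun v => 1 / (Ideal.absNorm v.asIdeal : ℝ)) :=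
    summable_of_hasFiniteSupport (hram.subset Set.support_indicator_subset)
  have h3 := summable_comp_under (F' := F) (fun _ => by positivity) (summable_one_div_absNorm_sq K)
  -- A prime in `D` is ramified, or inert of degree one over `K`, or of degree at least two over
  -- `K`. In the last case `N(v)` is at least the square of the norm of the prime below, so `h3`
  -- dominates.
  have hD' : Summable (D.indicator fun v => 1 / (Ideal.absNorm v.asIdeal : ℝ)) := by
    refine Summable.of_nonneg_of_le (fun v => Set.indicator_nonneg (fun _ _ => by positivity) _)
      (fun v => ?_) ((hsum.add h2).add h3)
    by_cases hvD : v ∈ D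
    · have h3v : 0 ≤ 1 / (Ideal.absNorm (v.under (𝓞 K)).asIdeal : ℝ) ^ 2 := by positivity
      have h2v : 0 ≤ Ram.indicator (fun v => 1 / (Ideal.absNorm v.asIdeal : ℝ)) v :=
        Set.indicator_nonneg (fun _ _ => by positivity) _
      have h1v := Set.indicator_nonneg (s := {v : HeightOneSpectrum (𝓞 F) |
        v.asIdeal.inertiaDeg (𝓞 K) = 1 ∧ (v.asIdeal.map (algebraMap (𝓞 F) (𝓞 F'))).IsPrime})
        (f := fun v => 1 / (Ideal.absNorm v.asIdeal : ℝ)) (fun _ _ => by positivity) v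
      rw [Set.indicator_of_mem hvD]
      by_cases hR : v ∈ Ram
      · rw [Set.indicator_of_mem hR]
        linarith
      by_cases hK : v.asIdeal.inertiaDeg (𝓞 K) = 1
      · rw [Set.indicator_of_mem (s := {v : HeightOneSpectrum (𝓞 F) | _ ∧ _})]
        · linarith
        · refine ⟨hK, ?_⟩
          by_contra hni
          refine hvD (exists_two_primes_of_unramified hdeg v (fun w hw hwv => ?_) hni)
          by_contra hram
          exact hR ⟨w, hw, hwv, hram⟩
      · refine le_trans ?_ (le_add_of_nonneg_left (add_nonneg h1v h2v))
        have hlies : v.asIdeal.LiesOver (v.under (𝓞 K)).asIdeal :=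
          HeightOneSpectrum.under_eq_iff.mp rfl
        have hN := Ideal.absNorm_pow_inertiaDeg (v.under (𝓞 K)).asIdeal v.asIdeal
        have hpos := v.asIdeal.inertiaDeg_pos (𝓞 K)
        have h2N := two_le_absNorm (v.under (𝓞 K))
        refine one_div_le_one_div_of_le (by positivity) ?_
        rw [← hN]
        push_cast
        exact pow_le_pow_right₀ (by exact_mod_cast (by omega : 1 ≤ _)) (by omega)
    · rw [Set.indicator_of_notMem hvD]
      refine add_nonneg (add_nonneg ?_ ?_) (by positivity) <;>
        exact Set.indicator_nonneg (fun _ _ => by positivity) _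
  exact summable_subtype_iff_indicator.mpr hD'

end QuadraticExtension

/-- Avoided classes for different primes are independent only over distinct primes of `K`, so one
representative is kept above each. Divergence survives: fibres are bounded and norms agree in degree
one. Then `1 - x ≤ exp(-x)` turns a large sum into a small product. -/
theorem exists_finset_prod_lt {K F : Type*} [Field K] [NumberField K] [Field F] [NumberField F]
    [Algebra K F] (G : Set (HeightOneSpectrum (𝓞 F)))
    (hG : ∀ v ∈ G, v.asIdeal.inertiaDeg (𝓞 K) = 1)
    (hsum : ¬ Summable (G.indicator fun v => 1 / (Ideal.absNorm v.asIdeal : ℝ)))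
    {ε : ℝ} (hε : 0 < ε) :
    ∃ T : Finset (HeightOneSpectrum (𝓞 F)), (∀ v ∈ T, v ∈ G) ∧
      Set.InjOn (fun v => v.under (𝓞 K)) (T : Set (HeightOneSpectrum (𝓞 F))) ∧
      ∏ v ∈ T, (1 - 1 / (Ideal.absNorm v.asIdeal : ℝ)) < ε := by
  classical
  have hN : ∀ v ∈ G, Ideal.absNorm (v.under (𝓞 K)).asIdeal = Ideal.absNorm v.asIdeal := by
    intro v hv
    have hlies : v.asIdeal.LiesOver (v.under (𝓞 K)).asIdeal :=
      HeightOneSpectrum.under_eq_iff.mp rfl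
    have := Ideal.absNorm_pow_inertiaDeg (v.under (𝓞 K)).asIdeal v.asIdeal
    rwa [hG v hv, pow_one] at this
  set Q : Set (HeightOneSpectrum (𝓞 K)) := (fun v => v.under (𝓞 K)) '' G with hQ
  have hQsum : ¬ Summable (Q.indicator fun v => 1 / (Ideal.absNorm v.asIdeal : ℝ)) := by
    intro h
    refine hsum ((summable_comp_under (F' := F)
      (fun v => Set.indicator_nonneg (fun _ _ => by positivity) v) h).of_nonneg_of_le
      (fun v => Set.indicator_nonneg (fun _ _ => by positivity) v) fun v => ?_)
    by_cases hv : v ∈ G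
    · rw [Set.indicator_of_mem hv, Set.indicator_of_mem (Set.mem_image_of_mem _ hv), hN v hv]
    · rw [Set.indicator_of_notMem hv]
      exact Set.indicator_nonneg (fun _ _ => by positivity) _
  obtain ⟨T, hT⟩ : ∃ T : Finset (HeightOneSpectrum (𝓞 K)), -Real.log ε <
      ∑ v ∈ T, Q.indicator (fun v => 1 / (Ideal.absNorm v.asIdeal : ℝ)) v := by
    by_contra! h
    exact hQsum (summable_of_sum_le
      (fun v => Set.indicator_nonneg (fun _ _ => by positivity) v) h)
  have : Nonempty (HeightOneSpectrum (𝓞 F)) := by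
    by_contra h
    have := not_nonempty_iff.mp h
    exact hsum summable_empty
  have hsec : ∀ q : HeightOneSpectrum (𝓞 K), q ∈ Q → ∃ v ∈ G, v.under (𝓞 K) = q := fun q hq => hq
  choose! r hrG hr using hsec
  set T' := T.filter (· ∈ Q)
  have hT' : ∀ q ∈ T', q ∈ Q := fun q hq => (Finset.mem_filter.mp hq).2
  have hinj : Set.InjOn r (T' : Set (HeightOneSpectrum (𝓞 K))) := by
    intro q hq q' hq' h
    rw [← hr q (hT' q hq), ← hr q' (hT' q' hq'), h]
  refine ⟨T'.image r, ?_, ?_, ?_⟩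
  · intro v hv
    obtain ⟨q, hq, rfl⟩ := Finset.mem_image.mp hv
    exact hrG q (hT' q hq)
  · intro v hv v' hv' h
    obtain ⟨q, hq, rfl⟩ := Finset.mem_image.mp hv
    obtain ⟨q', hq', rfl⟩ := Finset.mem_image.mp hv'
    simp only [hr q (hT' q hq), hr q' (hT' q' hq')] at h
    rw [h]
  · rw [Finset.prod_image hinj]
    calc ∏ q ∈ T', (1 - 1 / (Ideal.absNorm (r q).asIdeal : ℝ))
        ≤ ∏ q ∈ T', Real.exp (-(1 / (Ideal.absNorm q.asIdeal : ℝ))) := by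
          refine Finset.prod_le_prod (fun q _ => ?_) (fun q hq => ?_)
          · have : (2 : ℝ) ≤ Ideal.absNorm (r q).asIdeal := by exact_mod_cast two_le_absNorm _
            rw [sub_nonneg, div_le_one (by positivity)]
            linarith
          · have h1 := hN _ (hrG q (hT' q hq))
            rw [hr q (hT' q hq)] at h1
            rw [← h1]
            linarith [Real.add_one_le_exp (-(1 / (Ideal.absNorm q.asIdeal : ℝ)))]
      _ = Real.exp (-∑ q ∈ T', 1 / (Ideal.absNorm q.asIdeal : ℝ)) := by
          rw [← Real.exp_sum, Finset.sum_neg_distrib]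
      _ < ε := by
          rw [← Real.lt_log_iff_exp_lt hε]
          rw [Finset.sum_indicator_eq_sum_filter] at hT
          linarith

/-! ### Abstract densities and avoided residue classes. -/

section Density

variable {R : Type*} [CommRing R] {δ : Set R → ℝ}

theorem IsDensity.empty (hδ : IsDensity δ) [Infinite R] : δ ∅ = 0 := by
  refine le_antisymm ((hδ.mono ∅ ((⊥ : Ideal R) : Set R) (Set.empty_subset _)).trans ?_)
    (hδ.mem_Icc _).1
  rw [hδ.ideal, Nat.card_congr (RingEquiv.quotientBot R).toEquiv, Nat.card_eq_zero_of_infinite]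
  simp

theorem IsDensity.biUnion_le (hδ : IsDensity δ) [Infinite R] {ι : Type*} (s : Finset ι)
    (P : ι → Set R) : δ (⋃ i ∈ s, P i) ≤ ∑ i ∈ s, δ (P i) := by
  classical
  induction s using Finset.induction with
  | empty => simp [hδ.empty]
  | insert i s hi ih =>
    rw [Finset.set_biUnion_insert, Finset.sum_insert hi]
    linarith [hδ.union (P i) (⋃ j ∈ s, P j)]

theorem IsDensity.preimage_mk (hδ : IsDensity δ) (I : Ideal R) (c : R ⧸ I) :
    δ (Ideal.Quotient.mk I ⁻¹' {c}) = 1 / (Nat.card (R ⧸ I) : ℝ) := by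
  obtain ⟨a, rfl⟩ := Ideal.Quotient.mk_surjective c
  rw [← hδ.ideal I, ← hδ.translate a (I : Set R)]
  congr 1
  ext x
  simp only [Set.mem_preimage, Set.mem_singleton_iff, Set.mem_image, SetLike.mem_coe,
    Ideal.Quotient.eq]
  exact ⟨fun h => ⟨x - a, h, by ring⟩, by rintro ⟨y, hy, rfl⟩; simpa using hy⟩

/-- A set avoiding one residue class modulo each of finitely many maximal ideals. -/
theorem IsDensity.le_prod_one_sub (hδ : IsDensity δ) [Infinite R] {ι : Type*} (T : Finset ι)
    (P : ι → Ideal R) (hmax : ∀ i ∈ T, (P i).IsMaximal) (hinj : Set.InjOn P (T : Set ι))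
    (hfin : ∀ i ∈ T, Finite (R ⧸ P i)) (a : ι → R) (X : Set R)
    (hX : ∀ n ∈ X, ∀ i ∈ T, n - a i ∉ P i) :
    δ X ≤ ∏ i ∈ T, (1 - 1 / (Nat.card (R ⧸ P i) : ℝ)) := by
  classical
  have hfin' : ∀ i : T, Finite (R ⧸ P i.1) := fun i => hfin i.1 i.2
  have hmax' : ∀ i : T, (P i.1).IsMaximal := fun i => hmax i.1 i.2
  set J : Ideal R := ⨅ i : T, P i.1 with hJ
  let e : (R ⧸ J) ≃+* ∀ i : T, R ⧸ P i.1 := Ideal.quotientInfRingEquivPiQuotient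
    (fun i : T => P i.1) fun i j hij =>
      (Ideal.isCoprime_iff_sup_eq).mpr ((hmax' i).coprime_of_ne (hmax' j)
        fun h => hij (Subtype.ext (hinj i.2 j.2 h)))
  have he : ∀ (x : R) (i : T), e (Ideal.Quotient.mk J x) i = Ideal.Quotient.mk (P i.1) x :=
    fun x i => rfl
  have hJfin : Finite (R ⧸ J) := Finite.of_equiv _ e.symm.toEquiv
  let C : Set (R ⧸ J) := {c | ∀ i : T, e c i ≠ Ideal.Quotient.mk (P i.1) (a i.1)}
  have hCfin : C.Finite := Set.toFinite C
  have hXC : X ⊆ ⋃ c ∈ hCfin.toFinset, Ideal.Quotient.mk J ⁻¹' {c} := by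
    intro n hn
    simp only [Set.Finite.mem_toFinset, Set.mem_iUnion, Set.mem_preimage, Set.mem_singleton_iff,
      exists_prop]
    refine ⟨_, fun i h => ?_, rfl⟩
    rw [he, Ideal.Quotient.eq] at h
    exact hX n hn i.1 i.2 h
  -- By the Chinese remainder theorem an allowed class modulo `J` is a free choice of all but one
  -- class modulo each `P i`.
  have hCcard : (hCfin.toFinset.card : ℝ) = ∏ i : T, ((Nat.card (R ⧸ P i.1) : ℝ) - 1) := by
    let e' : C ≃ ∀ i : T, {x : R ⧸ P i.1 // x ≠ Ideal.Quotient.mk (P i.1) (a i.1)} :=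
      (e.toEquiv.subtypeEquiv (fun c => Iff.rfl)).trans
        (Equiv.subtypePiEquivPi (p := fun {i : T} (x : R ⧸ P i.1) =>
          x ≠ Ideal.Quotient.mk (P i.1) (a i.1)))
    rw [← Nat.card_eq_card_finite_toFinset hCfin, Nat.card_congr e', Nat.card_pi, Nat.cast_prod]
    refine Finset.prod_congr rfl fun i _ => ?_
    have := Fintype.ofFinite (R ⧸ P i.1)
    rw [Nat.card_eq_fintype_card, Nat.card_eq_fintype_card, Fintype.card_subtype_compl,
      Fintype.card_subtype_eq, Nat.cast_sub Fintype.card_pos, Nat.cast_one]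
  calc δ X ≤ ∑ c ∈ hCfin.toFinset, δ (Ideal.Quotient.mk J ⁻¹' {c}) :=
        (hδ.mono _ _ hXC).trans (hδ.biUnion_le _ _)
    _ = hCfin.toFinset.card * (1 / (Nat.card (R ⧸ J) : ℝ)) := by
        rw [Finset.sum_congr rfl fun c _ => hδ.preimage_mk J c, Finset.sum_const, nsmul_eq_mul]
    _ = ∏ i : T, (1 - 1 / (Nat.card (R ⧸ P i.1) : ℝ)) := by
        rw [hCcard, Nat.card_congr e.toEquiv, Nat.card_pi, Nat.cast_prod, one_div,
          ← Finset.prod_inv_distrib, ← Finset.prod_mul_distrib]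
        refine Finset.prod_congr rfl fun i _ => ?_
        have : (Nat.card (R ⧸ P i.1) : ℝ) ≠ 0 := by exact_mod_cast Nat.card_pos.ne'
        field_simp
    _ = _ := Finset.prod_coe_sort T (fun i => 1 - 1 / (Nat.card (R ⧸ P i) : ℝ))

end Density

/-! ### Inert primes, nonsquares and residue fields. -/

section Residues

variable {K F F' : Type*} [Field K] [NumberField K] [Field F] [NumberField F] [Field F']
  [NumberField F'] [Algebra K F] [Algebra F F']

/-- If `v` is odd and inert in `F(√d)`, and `d` is a unit at `v`, then `d` is not a square modulo
`v`. -/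
theorem not_valuation_sq_sub_lt_one [IsGalois F F'] {s : F'} {d : F} (hs : s ^ 2 = algebraMap F F' d)
    (hd : ¬ ∃ y : F, y ^ 2 = d) (v : HeightOneSpectrum (𝓞 F))
    (hv : (v.asIdeal.map (algebraMap (𝓞 F) (𝓞 F'))).IsPrime) (h2 : (2 : 𝓞 F) ∉ v.asIdeal)
    (hvd : v.valuation F d = 1) {x : F} (hx : v.valuation F x ≤ 1) :
    ¬ v.valuation F (x ^ 2 - d) < 1 := by
  intro hlt
  obtain ⟨τ, hτ⟩ : ∃ τ : Gal(F'/F), τ s = -s := by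
    have hns : ∃ τ : Gal(F'/F), τ s ≠ s := by
      by_contra! h
      obtain ⟨y, hy⟩ := IntermediateField.mem_bot.mp ((IsGalois.mem_bot_iff_fixed s).mpr h)
      refine hd ⟨y, (algebraMap F F').injective ?_⟩
      rw [map_pow, hy, hs]
    obtain ⟨τ, hτ⟩ := hns
    have h := congrArg τ hs
    rw [AlgEquiv.commutes, map_pow, ← hs] at h
    exact ⟨τ, (sq_eq_sq_iff_eq_or_eq_neg.mp h).resolve_left hτ⟩
  obtain ⟨n, m, hnm⟩ := v.exists_primeCompl_mul_eq_of_integer x hx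
  obtain ⟨n', m', hnm'⟩ := v.exists_primeCompl_mul_eq_of_integer d hvd.le
  -- A common denominator `M` prime to `v` replaces `x`, `d`, `s` by the integral elements `X = xM`,
  -- `D = dM²`, `σ = sM`.
  obtain ⟨M, hM⟩ : ∃ M : 𝓞 F, M = m.1 * m'.1 := ⟨_, rfl⟩
  have hMv : M ∉ v.asIdeal := by
    rw [hM]
    exact fun h => (v.isPrime.mem_or_mem h).elim m.2 m'.2
  have hvM : v.valuation F (algebraMap (𝓞 F) F M) = 1 := v.valuation_eq_one_iff_notMem.mpr hMv
  obtain ⟨X, hX⟩ : ∃ X : 𝓞 F, X = n * m' := ⟨_, rfl⟩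
  obtain ⟨D, hD⟩ : ∃ D : 𝓞 F, D = n' * m' * m ^ 2 := ⟨_, rfl⟩
  have hXx : algebraMap (𝓞 F) F X = x * algebraMap (𝓞 F) F M := by
    rw [hX, hM, map_mul, map_mul, ← hnm]
    ring
  have hDd : algebraMap (𝓞 F) F D = d * algebraMap (𝓞 F) F M ^ 2 := by
    rw [hD, hM, map_mul, map_mul, map_mul, map_pow, ← hnm']
    ring
  have hmem : X ^ 2 - D ∈ v.asIdeal := by
    refine (v.valuation_lt_one_iff_mem (K := F) _).mp ?_
    change v.valuation F (algebraMap (𝓞 F) F _) < 1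
    rw [map_sub, map_pow, hXx, hDd,
      show (x * algebraMap (𝓞 F) F M) ^ 2 - d * algebraMap (𝓞 F) F M ^ 2 =
        (x ^ 2 - d) * algebraMap (𝓞 F) F M ^ 2 by ring, map_mul, map_pow, hvM, one_pow, mul_one]
    exact hlt
  have hDv : D ∉ v.asIdeal := by
    rw [← v.valuation_eq_one_iff_notMem (K := F), hDd, map_mul, map_pow, hvM, hvd, one_pow, mul_one]
  have hsM : (s * algebraMap (𝓞 F) F' M) ^ 2 = algebraMap (𝓞 F) F' D := by
    rw [mul_pow, hs, IsScalarTower.algebraMap_apply (𝓞 F) F F' D, hDd, map_mul, map_pow,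
      ← IsScalarTower.algebraMap_apply]
  have hint : IsIntegral ℤ (s * algebraMap (𝓞 F) F' M) := by
    refine IsIntegral.of_pow two_pos ?_
    rw [hsM]
    exact (RingOfIntegers.isIntegral D).map (IsScalarTower.toAlgHom ℤ (𝓞 F) F')
  set σ : 𝓞 F' := ⟨s * algebraMap (𝓞 F) F' M, hint⟩ with hσ
  set P := v.asIdeal.map (algebraMap (𝓞 F) (𝓞 F')) with hP
  set τ' : 𝓞 F' →ₐ[𝓞 F] 𝓞 F' := RingOfIntegers.mapAlgHom τ with hτ'
  have hτσ : τ' σ = -σ := by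
    apply RingOfIntegers.ext
    change τ (s * algebraMap (𝓞 F) F' M) = -(s * algebraMap (𝓞 F) F' M)
    rw [map_mul, hτ, IsScalarTower.algebraMap_apply (𝓞 F) F F' M, AlgEquiv.commutes, neg_mul]
  have hτP : ∀ z ∈ P, τ' z ∈ P := by
    have : P ≤ P.comap (τ' : 𝓞 F' →+* 𝓞 F') := by
      rw [hP, Ideal.map_le_iff_le_comap]
      intro z hz
      rw [Ideal.mem_comap, Ideal.mem_comap]
      change τ' (algebraMap _ _ z) ∈ _
      rw [AlgHom.commutes]
      exact Ideal.mem_map_of_mem _ hz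
    exact fun z hz => this hz
  have hcomap : P.comap (algebraMap (𝓞 F) (𝓞 F')) = v.asIdeal :=
    (v.isMaximal.eq_of_le (Ideal.comap_ne_top _ hv.ne_top) Ideal.le_comap_map).symm
  have hσ2 : σ ^ 2 = algebraMap (𝓞 F) (𝓞 F') D := RingOfIntegers.ext hsM
  have hprod : (algebraMap (𝓞 F) (𝓞 F') X - σ) * (algebraMap (𝓞 F) (𝓞 F') X + σ) ∈ P := by
    rw [show (algebraMap (𝓞 F) (𝓞 F') X - σ) * (algebraMap (𝓞 F) (𝓞 F') X + σ) =
      algebraMap (𝓞 F) (𝓞 F') X ^ 2 - σ ^ 2 by ring, hσ2, ← map_pow, ← map_sub]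
    exact Ideal.mem_map_of_mem _ hmem
  -- The conjugation `τ` preserves `P` and exchanges `X - σ` and `X + σ`; as `P` is prime, both lie
  -- in it. Their sum `2X` then puts `X`, and so `D`, in `v`.
  have hboth : (algebraMap (𝓞 F) (𝓞 F') X - σ) ∈ P ∧ (algebraMap (𝓞 F) (𝓞 F') X + σ) ∈ P := by
    rcases hv.mem_or_mem hprod with h | h
    · refine ⟨h, ?_⟩
      have := hτP _ h
      rwa [map_sub, hτσ, AlgHom.commutes, sub_neg_eq_add] at this
    · refine ⟨?_, h⟩
      have := hτP _ h
      rwa [map_add, hτσ, AlgHom.commutes, ← sub_eq_add_neg] at this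
  have h2X : 2 * X ∈ v.asIdeal := by
    rw [← hcomap, Ideal.mem_comap, show algebraMap (𝓞 F) (𝓞 F') (2 * X) =
      (algebraMap (𝓞 F) (𝓞 F') X - σ) + (algebraMap (𝓞 F) (𝓞 F') X + σ) by
        rw [map_mul, map_ofNat]; ring]
    exact P.add_mem hboth.1 hboth.2
  have hXv := (v.isPrime.mem_or_mem h2X).resolve_left h2
  refine hDv ?_
  rw [show D = X * X - (X ^ 2 - D) by ring]
  exact v.asIdeal.sub_mem (v.asIdeal.mul_mem_left _ hXv) hmem

theorem valuation_algebraMap_le_one_of_under (v : HeightOneSpectrum (𝓞 F)) {r : K}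
    (hr : (v.under (𝓞 K)).valuation K r ≤ 1) : v.valuation F (algebraMap K F r) ≤ 1 := by
  obtain ⟨a, b, hab⟩ := (v.under (𝓞 K)).exists_primeCompl_mul_eq_of_integer r hr
  have hb : v.valuation F (algebraMap (𝓞 F) F (algebraMap (𝓞 K) (𝓞 F) b)) = 1 :=
    v.valuation_eq_one_iff_notMem.mpr b.2
  have h : algebraMap K F r * algebraMap (𝓞 F) F (algebraMap (𝓞 K) (𝓞 F) b) =
      algebraMap (𝓞 F) F (algebraMap (𝓞 K) (𝓞 F) a) := by
    rw [← IsScalarTower.algebraMap_apply (𝓞 K) (𝓞 F) F, ← IsScalarTower.algebraMap_apply (𝓞 K) (𝓞 F) F,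
      IsScalarTower.algebraMap_apply (𝓞 K) K F, IsScalarTower.algebraMap_apply (𝓞 K) K F, ← hab,
      map_mul]
  have := congrArg (v.valuation F) h
  rw [map_mul, hb, mul_one] at this
  rw [this]
  exact v.valuation_le_one _

theorem valuation_algebraMap_lt_one_of_under (v : HeightOneSpectrum (𝓞 F)) {r : K}
    (hr : (v.under (𝓞 K)).valuation K r < 1) : v.valuation F (algebraMap K F r) < 1 := by
  obtain ⟨a, b, hab⟩ := (v.under (𝓞 K)).exists_primeCompl_mul_eq_of_integer r hr.le
  have hb : v.valuation F (algebraMap (𝓞 F) F (algebraMap (𝓞 K) (𝓞 F) b)) = 1 :=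
    v.valuation_eq_one_iff_notMem.mpr b.2
  have ha : a ∈ (v.under (𝓞 K)).asIdeal := by
    refine ((v.under (𝓞 K)).valuation_lt_one_iff_mem (K := K) _).mp ?_
    change (v.under (𝓞 K)).valuation K (algebraMap (𝓞 K) K a) < 1
    rw [← hab, map_mul,
      (v.under (𝓞 K)).valuation_eq_one_iff_notMem.mpr b.2, mul_one]
    exact hr
  have h : algebraMap K F r * algebraMap (𝓞 F) F (algebraMap (𝓞 K) (𝓞 F) b) =
      algebraMap (𝓞 F) F (algebraMap (𝓞 K) (𝓞 F) a) := by
    rw [← IsScalarTower.algebraMap_apply (𝓞 K) (𝓞 F) F, ← IsScalarTower.algebraMap_apply (𝓞 K) (𝓞 F) F,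
      IsScalarTower.algebraMap_apply (𝓞 K) K F, IsScalarTower.algebraMap_apply (𝓞 K) K F, ← hab,
      map_mul]
  have := congrArg (v.valuation F) h
  rw [map_mul, hb, mul_one] at this
  rw [this]
  exact (v.valuation_lt_one_iff_mem _).mpr ha

theorem exists_sub_mem_of_inertiaDeg_eq_one (v : HeightOneSpectrum (𝓞 F))
    (hv : v.asIdeal.inertiaDeg (𝓞 K) = 1) (z : 𝓞 F) :
    ∃ a : 𝓞 K, algebraMap (𝓞 K) (𝓞 F) a - z ∈ v.asIdeal := by
  have hlies : v.asIdeal.LiesOver (v.under (𝓞 K)).asIdeal :=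
    HeightOneSpectrum.under_eq_iff.mp rfl
  have := v.isMaximal
  have := (v.under (𝓞 K)).isMaximal
  rw [Ideal.inertiaDeg_eq_of_isMaximal (v.under (𝓞 K)).asIdeal] at hv
  let _ : Field (𝓞 K ⧸ (v.under (𝓞 K)).asIdeal) := Ideal.Quotient.field _
  have htop := Subalgebra.bot_eq_top_of_finrank_eq_one hv
  have hz : Ideal.Quotient.mk v.asIdeal z ∈
      (⊥ : Subalgebra (𝓞 K ⧸ (v.under (𝓞 K)).asIdeal) (𝓞 F ⧸ v.asIdeal)) := htop ▸ trivial
  obtain ⟨a, ha⟩ := Algebra.mem_bot.mp hz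
  obtain ⟨a, rfl⟩ := Ideal.Quotient.mk_surjective a
  exact ⟨a, Ideal.Quotient.eq.mp ha⟩

end Residues

/-! ### Residue fields of the ring of `S`-integers. -/

section SIntegers

variable {K : Type*} [Field K] [NumberField K]

/-- The prime ideal of the ring of `S`-integers defined by a prime `q ∉ S`. -/
def sIntegerPrime (S : Set (HeightOneSpectrum (𝓞 K))) (q : HeightOneSpectrum (𝓞 K)) (hq : q ∉ S) :
    Ideal (S.integer K) where
  carrier := {r | q.valuation K r < 1}
  add_mem' {a b} ha hb := by
    change q.valuation K ((a : K) + b) < 1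
    exact Valuation.map_add_lt _ ha hb
  zero_mem' := by
    change q.valuation K (0 : K) < 1
    simp
  smul_mem' c r hr := by
    have hr' : q.valuation K r < 1 := hr
    change q.valuation K ((c : K) * r) < 1
    rw [map_mul]
    exact (mul_le_of_le_one_left' (c.2 q hq)).trans_lt hr'

theorem mem_sIntegerPrime {S : Set (HeightOneSpectrum (𝓞 K))} {q : HeightOneSpectrum (𝓞 K)}
    {hq : q ∉ S} {r : S.integer K} : r ∈ sIntegerPrime S q hq ↔ q.valuation K (r : K) < 1 := Iff.rfl

theorem comap_sIntegerPrime (S : Set (HeightOneSpectrum (𝓞 K))) (q : HeightOneSpectrum (𝓞 K))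
    (hq : q ∉ S) : (sIntegerPrime S q hq).comap (algebraMap (𝓞 K) (S.integer K)) = q.asIdeal := by
  ext a
  rw [Ideal.mem_comap, mem_sIntegerPrime]
  exact q.valuation_lt_one_iff_mem a

/-- The residue field of the ring of `S`-integers at `q ∉ S` is that of the ring of integers. -/
noncomputable def quotientSIntegerPrimeEquiv (S : Set (HeightOneSpectrum (𝓞 K)))
    (q : HeightOneSpectrum (𝓞 K)) (hq : q ∉ S) :
    (𝓞 K ⧸ q.asIdeal) ≃+* (S.integer K ⧸ sIntegerPrime S q hq) :=
  RingEquiv.ofBijective (Ideal.quotientMap (sIntegerPrime S q hq)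
    (algebraMap (𝓞 K) (S.integer K)) (comap_sIntegerPrime S q hq).ge) <| by
    constructor
    · exact Ideal.quotientMap_injective' (comap_sIntegerPrime S q hq).le
    · intro r
      obtain ⟨r, rfl⟩ := Ideal.Quotient.mk_surjective r
      obtain ⟨a, ha⟩ := q.exists_valuation_sub_lt_of_integer (r.2 q hq) 1
      refine ⟨Ideal.Quotient.mk _ a, ?_⟩
      rw [Ideal.quotientMap_mk, Ideal.Quotient.eq]
      exact ha

theorem isMaximal_sIntegerPrime (S : Set (HeightOneSpectrum (𝓞 K)))
    (q : HeightOneSpectrum (𝓞 K)) (hq : q ∉ S) : (sIntegerPrime S q hq).IsMaximal := by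
  have := q.isMaximal
  exact Ideal.Quotient.maximal_of_isField _ ((quotientSIntegerPrimeEquiv S q hq).symm.toMulEquiv.isField
    (Ideal.Quotient.field q.asIdeal).toIsField)

theorem card_quotient_sIntegerPrime (S : Set (HeightOneSpectrum (𝓞 K)))
    (q : HeightOneSpectrum (𝓞 K)) (hq : q ∉ S) :
    Nat.card (S.integer K ⧸ sIntegerPrime S q hq) = Ideal.absNorm q.asIdeal :=
  (Nat.card_congr (quotientSIntegerPrimeEquiv S q hq).toEquiv).symm

theorem finite_quotient_sIntegerPrime (S : Set (HeightOneSpectrum (𝓞 K)))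
    (q : HeightOneSpectrum (𝓞 K)) (hq : q ∉ S) :
    Finite (S.integer K ⧸ sIntegerPrime S q hq) :=
  have := Ideal.finiteQuotientOfFreeOfNeBot q.asIdeal q.ne_bot
  Finite.of_equiv _ (quotientSIntegerPrimeEquiv S q hq).toEquiv

end SIntegers

/-! ### `S`-units modulo squares. -/

section SUnits

variable {K : Type*} [Field K] [NumberField K]

/-- The group of `S`-units of a number field is finitely generated if `S` is finite. -/
theorem fg_units_integer (S : Set (HeightOneSpectrum (𝓞 K))) (hS : S.Finite) :
    Module.Finite ℤ (Additive (S.integer K)ˣ) := by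
  have := hS.to_subtype
  let val : (S.integer K)ˣ →* (S → Multiplicative ℤ) := MonoidHom.pi fun v =>
    v.1.valuationOfNeZero.comp (Units.map ((S.integer K).val : S.integer K →* K))
  let i : (𝓞 K)ˣ →* (S.integer K)ˣ := Units.map (algebraMap (𝓞 K) (S.integer K) : 𝓞 K →* _)
  let f : Additive (S.integer K)ˣ →ₗ[ℤ] (S → ℤ) := AddMonoidHom.toIntLinearMap
    { toFun := fun x v => (val x.toMul v).toAdd
      map_zero' := by ext v; simp
      map_add' := fun x y => by ext v; simp }
  let g : Additive (𝓞 K)ˣ →ₗ[ℤ] Additive (S.integer K)ˣ :=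
    AddMonoidHom.toIntLinearMap (MonoidHom.toAdditive i)
  refine ⟨Submodule.fg_of_fg_map_of_fg_inf_ker f (IsNoetherian.noetherian _) ?_⟩
  -- An `S`-unit of trivial valuation at `S` is integral everywhere, as is its inverse, so it comes
  -- from a unit of `𝓞 K`; those units are finitely generated by Dirichlet's theorem.
  have hker : (⊤ : Submodule ℤ (Additive (S.integer K)ˣ)) ⊓ LinearMap.ker f = LinearMap.range g ⊓ LinearMap.ker f := by
    rw [top_inf_eq, eq_comm, inf_eq_right]
    intro x hx
    set u : (S.integer K)ˣ := x.toMul with hu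
    have hv : ∀ w : (S.integer K)ˣ, f (Additive.ofMul w) = 0 → ∀ v : HeightOneSpectrum (𝓞 K),
        v.valuation K ((w : S.integer K) : K) ≤ 1 := by
      intro w hw v
      by_cases hvS : v ∈ S
      · have h1 : val w ⟨v, hvS⟩ = 1 := congrFun hw ⟨v, hvS⟩
        have h2 := v.valuationOfNeZero_eq (Units.map ((S.integer K).val : S.integer K →* K) w)
        have h3 : v.valuationOfNeZero (Units.map ((S.integer K).val : S.integer K →* K) w) = 1 := h1
        rw [h3] at h2
        exact le_of_eq h2.symm
      · exact (w : S.integer K).2 v hvS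
    have hu0 : f (Additive.ofMul u) = 0 := hx
    have hu1 : f (Additive.ofMul u⁻¹) = 0 := by
      rw [ofMul_inv, map_neg, hu0, neg_zero]
    obtain ⟨a, ha⟩ := HeightOneSpectrum.mem_integers_of_valuation_le_one K _ (hv u hu0)
    obtain ⟨b, hb⟩ := HeightOneSpectrum.mem_integers_of_valuation_le_one K _ (hv u⁻¹ hu1)
    have hab : a * b = 1 := by
      apply RingOfIntegers.ext
      change algebraMap (𝓞 K) K (a * b) = algebraMap (𝓞 K) K 1
      rw [map_mul, ha, hb, map_one, ← MulMemClass.coe_mul, Units.mul_inv]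
      rfl
    refine ⟨Additive.ofMul (Units.mkOfMulEqOne a b hab), ?_⟩
    have : i (Units.mkOfMulEqOne a b hab) = u := Units.ext (Subtype.ext ha)
    exact congrArg Additive.ofMul this
  rw [hker]
  have : IsNoetherian ℤ (LinearMap.range g) :=
    isNoetherian_of_surjective g.rangeRestrict g.range_rangeRestrict
  exact isNoetherian_submodule.mp this _ inf_le_left

theorem finite_units_quotient_square (S : Set (HeightOneSpectrum (𝓞 K))) (hS : S.Finite) :
    Finite ((S.integer K)ˣ ⧸ Subgroup.square (S.integer K)ˣ) := by
  have hfin := fg_units_integer S hS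
  have : Group.FG (S.integer K)ˣ := by
    rwa [Group.fg_iff_monoid_fg, Monoid.fg_iff_add_fg, ← AddGroup.fg_iff_addMonoid_fg,
      ← Module.Finite.iff_addGroup_fg]
  have : Group.FG ((S.integer K)ˣ ⧸ Subgroup.square (S.integer K)ˣ) := inferInstance
  refine CommGroup.finite_of_fg_isMulTorsion _ fun x => ?_
  obtain ⟨u, rfl⟩ := QuotientGroup.mk_surjective x
  refine isOfFinOrder_iff_pow_eq_one.mpr ⟨2, two_pos, ?_⟩
  rw [← QuotientGroup.mk_pow, QuotientGroup.eq_one_iff]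
  exact ⟨u, sq u⟩

end SUnits

/-! ### The principal genus and squares modulo `f`. -/

section Genus

/-- A substitution only moves the arguments, so equivalence changes values by the inverse
determinant alone; `diag(1, e⁻¹)` realizes any unit `e`. -/
theorem BinForm.mem_classVals_iff {R : Type*} [CommRing R] (Δ : R) (q : BinForm R)
    (w : (R ⧸ Ideal.span {Δ})ˣ) :
    w ∈ BinForm.classVals Δ q ↔ ∃ (e : Rˣ) (x y : R ⧸ Ideal.span {Δ}),
      (w : R ⧸ Ideal.span {Δ}) = Ideal.Quotient.mk _ (e : R) *
        (q.map (Ideal.Quotient.mk _)).eval x y := by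
  simp only [BinForm.classVals, Set.mem_iUnion, exists_prop]
  constructor
  · rintro ⟨q', ⟨M, rfl⟩, x, y, h⟩
    refine ⟨(Matrix.GeneralLinearGroup.det M)⁻¹,
      Ideal.Quotient.mk _ (M 0 0) * x + Ideal.Quotient.mk _ (M 0 1) * y,
      Ideal.Quotient.mk _ (M 1 0) * x + Ideal.Quotient.mk _ (M 1 1) * y, h.trans ?_⟩
    obtain ⟨x, rfl⟩ := Ideal.Quotient.mk_surjective x
    obtain ⟨y, rfl⟩ := Ideal.Quotient.mk_surjective y
    have := congrArg (Ideal.Quotient.mk (Ideal.span {Δ})) (BinForm.eval_twistedAct M q x y)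
    simp only [BinForm.eval, BinForm.map, map_add, map_mul, map_pow] at this ⊢
    exact this
  · rintro ⟨e, x, y, h⟩
    let M : GL (Fin 2) R := ⟨!![1, 0; 0, ((e⁻¹ : Rˣ) : R)], !![1, 0; 0, (e : R)],
      by simp [Matrix.one_fin_two], by simp [Matrix.one_fin_two]⟩
    have hdet : (Matrix.GeneralLinearGroup.det M)⁻¹ = e := by
      rw [inv_eq_iff_eq_inv]
      ext
      simp [M, Matrix.det_fin_two]
    refine ⟨BinForm.twistedAct M q, ⟨M, rfl⟩, x, Ideal.Quotient.mk _ (e : R) * y, h.trans ?_⟩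
    obtain ⟨x, rfl⟩ := Ideal.Quotient.mk_surjective x
    obtain ⟨y, rfl⟩ := Ideal.Quotient.mk_surjective y
    have := congrArg (Ideal.Quotient.mk (Ideal.span {Δ})) (BinForm.eval_twistedAct M q x (e * y))
    rw [hdet, show M 0 0 * x + M 0 1 * (e * y) = x by simp [M],
      show M 1 0 * x + M 1 1 * (e * y) = y by simp [M]] at this
    simp only [BinForm.eval, BinForm.map, map_add, map_mul, map_pow] at this ⊢
    exact this.symm

/-- A form `[a, 2b, c]` of discriminant `4f`, with `a` invertible modulo `f` and a unit multiple of
`a` a square modulo `f`, is in the principal genus. -/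
theorem BinForm.inPrincipalGenus_of_dvd {R : Type*} [CommRing R] {a b c f h : R} (e : Rˣ)
    (h4 : IsUnit (4 : R)) (hdisc : b ^ 2 - a * c = f) (hcop : IsCoprime a f)
    (hsq : f ∣ h ^ 2 - e * a) : BinForm.InPrincipalGenus f ⟨a, 2 * b, c⟩ := by
  set I : Ideal R := Ideal.span {4 * f} with hI
  let π := Ideal.Quotient.mk I
  have hf0 : π f = 0 := by
    rw [Ideal.Quotient.eq_zero_iff_mem, hI, Ideal.mem_span_singleton]
    obtain ⟨u, hu⟩ := h4
    exact ⟨((u⁻¹ : Rˣ) : R), by rw [← hu]; linear_combination (-f) * u.mul_inv⟩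
  obtain ⟨r, s, hrs⟩ := hcop
  have hra : π r * π a = 1 := by
    have := congrArg π hrs
    rwa [map_add, map_mul, map_mul, hf0, mul_zero, add_zero, map_one] at this
  have hh : π h ^ 2 = π e * π a := by
    obtain ⟨k, hk⟩ := hsq
    have := congrArg π hk
    rw [map_mul, hf0, zero_mul, map_sub, map_pow, map_mul, sub_eq_zero] at this
    exact this
  have hee : π e * π ((e⁻¹ : Rˣ) : R) = 1 := by rw [← map_mul, Units.mul_inv, map_one]
  have hbac : π b ^ 2 = π a * π c := by
    have := congrArg π hdisc
    rw [hf0, map_sub, map_pow, map_mul, sub_eq_zero] at this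
    exact this
  -- the inverse of `h` modulo `f`
  set k := π h * π r * π ((e⁻¹ : Rˣ) : R) with hk
  have hhk : π h * k = 1 := by
    rw [hk]
    linear_combination (π r * π ((e⁻¹ : Rˣ) : R)) * hh + (π e * π ((e⁻¹ : Rˣ) : R)) * hra + hee
  ext w
  rw [BinForm.mem_classVals_iff, BinForm.mem_classVals_iff]
  constructor
  · rintro ⟨e', x, y, hw⟩
    -- Modulo `f`, `a q(x, y) = (a x + b y)²` and `a⁻¹ = e k²`, so `q(x, y) = e ((a x + b y) k)²`.
    refine ⟨e' * e, (π a * x + π b * y) * k, 0, hw.trans ?_⟩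
    simp only [BinForm.eval, BinForm.map, BinForm.principal, Units.val_mul, map_mul, map_one,
      map_neg, map_zero, map_ofNat]
    change π e' * (π a * x ^ 2 + 2 * π b * x * y + π c * y ^ 2) = π e' * π e *
      (1 * ((π a * x + π b * y) * k) ^ 2 + 0 * _ * 0 + -(π f) * 0 ^ 2)
    have h1 : π a * (π e * k ^ 2) = 1 := by
      linear_combination (π h * k + 1) * hhk - k ^ 2 * hh
    have h2 : (π a * x + π b * y) ^ 2 = π a * (π a * x ^ 2 + 2 * π b * x * y + π c * y ^ 2) := by
      linear_combination y ^ 2 * hbac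
    linear_combination (-π e' * (π a * x ^ 2 + 2 * π b * x * y + π c * y ^ 2)) * h1 -
      (π e' * π e * k ^ 2) * h2
  · rintro ⟨e', x, y, hw⟩
    -- Conversely the principal form is `x²` modulo `f`, and `x² = e a (x k)²`.
    refine ⟨e' * e, x * k, 0, hw.trans ?_⟩
    simp only [BinForm.eval, BinForm.map, BinForm.principal, Units.val_mul, map_mul, map_one,
      map_neg, map_zero, map_ofNat]
    change π e' * (1 * x ^ 2 + 0 * x * y + -(π f) * y ^ 2) = π e' * π e *
      (π a * (x * k) ^ 2 + 2 * π b * (x * k) * 0 + π c * 0 ^ 2)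
    rw [hf0]
    have h1 : π a * (π e * k ^ 2) = 1 := by
      linear_combination (π h * k + 1) * hhk - k ^ 2 * hh
    linear_combination (-π e' * x ^ 2) * h1

/-- An element of `K[X]` whose values at all roots of a square-free polynomial `g` are squares is a
square modulo `g`. -/
theorem exists_dvd_sq_sub {K : Type*} [Field K] (a : K[X]) (g : K[X]) (hg : Squarefree g)
    (h : ∀ ρ : AlgebraicClosure K, aeval ρ g = 0 →
      ∃ y : K⟮ρ⟯, y ^ 2 = aeval (AdjoinSimple.gen K ρ) a) :
    ∃ z : K[X], g ∣ z ^ 2 - a := by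
  induction g using WfDvdMonoid.induction_on_irreducible with
  | zero => exact (not_squarefree_zero hg).elim
  | unit u hu => exact ⟨0, hu.dvd⟩
  | mul g p hg0 hp ih =>
    obtain ⟨z₁, hz₁⟩ := ih (hg.of_mul_right) fun ρ hρ => h ρ (by rw [map_mul, hρ, mul_zero])
    obtain ⟨ρ, hρ⟩ := IsAlgClosed.exists_aeval_eq_zero (AlgebraicClosure K) p
      (degree_pos_of_irreducible hp).ne'
    obtain ⟨y, hy⟩ := h ρ (by rw [map_mul, hρ, zero_mul])
    have hint : IsIntegral K ρ := Algebra.IsIntegral.isIntegral ρ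
    obtain ⟨z₂, hz₂⟩ : ∃ z₂ : K[X], aeval ρ z₂ = (y : AlgebraicClosure K) := by
      have hy2 : (y : AlgebraicClosure K) ∈ K⟮ρ⟯.toSubalgebra := y.2
      rwa [adjoin_simple_toSubalgebra_of_isAlgebraic hint.isAlgebraic,
        Algebra.adjoin_singleton_eq_range_aeval] at hy2
    have hpz₂ : p ∣ z₂ ^ 2 - a := by
      have h0 : aeval ρ (z₂ ^ 2 - a) = 0 := by
        have := congrArg (algebraMap K⟮ρ⟯ (AlgebraicClosure K)) hy
        rw [map_pow, ← aeval_algebraMap_apply, AdjoinSimple.algebraMap_gen] at this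
        rw [map_sub, map_pow, hz₂, sub_eq_zero]
        exact this
      exact ((minpoly.irreducible hint).associated_of_dvd hp (minpoly.dvd K ρ hρ)).dvd_iff_dvd_left.mp
        (minpoly.dvd K ρ h0)
    have hcop : IsCoprime p g := by
      rw [hp.coprime_iff_not_dvd]
      intro hdvd
      exact hp.not_isUnit (hg p (mul_dvd_mul_left p hdvd))
    obtain ⟨r, s, hrs⟩ := hcop
    -- Chinese remainder: this element is `z₂` modulo `p` and `z₁` modulo `g`.
    refine ⟨z₁ * (r * p) + z₂ * (s * g), IsCoprime.mul_dvd ⟨r, s, hrs⟩ ?_ ?_⟩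
    · have : (z₁ * (r * p) + z₂ * (s * g)) ^ 2 - a =
          (z₂ ^ 2 - a) + p * (r * (z₁ - z₂) * (2 * z₂ + (z₁ - z₂) * (r * p))) := by
        rw [show s * g = 1 - r * p by rw [← hrs]; ring]
        ring
      rw [this]
      exact dvd_add hpz₂ (dvd_mul_right _ _)
    · have : (z₁ * (r * p) + z₂ * (s * g)) ^ 2 - a =
          (z₁ ^ 2 - a) + g * (s * (z₂ - z₁) * (2 * z₁ + (z₂ - z₁) * (s * g))) := by
        rw [show r * p = 1 - s * g by rw [← hrs]; ring]
        ring
      rw [this]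
      exact dvd_add hz₁ (dvd_mul_right _ _)

/-- Gauss's lemma: over an integrally closed domain, a factor of `f` over `K` is a constant times a
monic polynomial over `R`, so a square factor descends. -/
theorem Polynomial.Monic.squarefree_map {R : Type*} (K : Type*) [CommRing R] [IsDomain R]
    [IsIntegrallyClosed R] [Field K] [Algebra R K] [IsFractionRing R K] {f : R[X]} (hf : f.Monic)
    (hsq : Squarefree f) : Squarefree (f.map (algebraMap R K)) := by
  intro g hg
  obtain ⟨g', hg'⟩ := IsIntegrallyClosed.eq_map_mul_C_of_dvd K hf (dvd_of_mul_right_dvd hg)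
  have hg0 : g.leadingCoeff ≠ 0 := leadingCoeff_ne_zero.mpr
    (ne_zero_of_dvd_ne_zero (hf.map (algebraMap R K)).ne_zero (dvd_of_mul_right_dvd hg))
  have hu : IsUnit (C g.leadingCoeff) := isUnit_C.mpr hg0.isUnit
  have hmon : g'.Monic := by
    refine Polynomial.monic_of_injective (IsFractionRing.injective R K) ?_
    have := congrArg Polynomial.leadingCoeff hg'
    rw [Polynomial.leadingCoeff_mul, Polynomial.leadingCoeff_C] at this
    exact (mul_eq_right₀ hg0).mp this
  have hdvd : (g' * g').map (algebraMap R K) ∣ f.map (algebraMap R K) := by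
    refine dvd_trans ?_ hg
    nth_rewrite 2 [← hg']
    rw [← hg', Polynomial.map_mul]
    exact mul_dvd_mul (dvd_mul_right _ _) (dvd_mul_right _ _)
  rw [Polynomial.map_dvd_map _ (IsFractionRing.injective R K) (hmon.mul hmon)] at hdvd
  rw [← hg']
  exact ((hsq g' hdvd).map (mapRingHom (algebraMap R K))).mul hu

end Genus

/-! ### Adjoining a square root. -/

section SqrtExt

variable {F Ω : Type*} [Field F] [Field Ω] [Algebra F Ω]

theorem sqrtExt_eq_adjoin_simple (d : F) {s : Ω} (hs : s ^ 2 = algebraMap F Ω d) :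
    sqrtExt (Ω := Ω) d = F⟮s⟯ := by
  refine le_antisymm (adjoin_le_iff.mpr fun t ht => ?_) (adjoin_le_iff.mpr ?_)
  · have hmem := mem_adjoin_simple_self F s
    have ht' : t ^ 2 = algebraMap F Ω d := ht
    rw [← hs] at ht'
    rcases sq_eq_sq_iff_eq_or_eq_neg.mp ht' with rfl | rfl
    · exact hmem
    · exact neg_mem hmem
  · rintro t rfl
    exact subset_adjoin F _ hs

theorem finrank_sqrtExt (d : F) (hd : ¬ ∃ y : F, y ^ 2 = d) {s : Ω} (hs : s ^ 2 = algebraMap F Ω d) :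
    Module.finrank F (sqrtExt (Ω := Ω) d) = 2 := by
  have hirr : Irreducible (X ^ 2 - C d : F[X]) :=
    X_pow_sub_C_irreducible_of_prime Nat.prime_two fun b hb => hd ⟨b, hb⟩
  have hmonic : (X ^ 2 - C d : F[X]).Monic := monic_X_pow_sub_C d two_ne_zero
  have hroot : aeval s (X ^ 2 - C d : F[X]) = 0 := by simp [hs]
  have hmin := minpoly.eq_of_irreducible_of_monic hirr hroot hmonic
  have hint : IsIntegral F s := ⟨_, hmonic, hroot⟩
  rw [sqrtExt_eq_adjoin_simple d hs, adjoin.finrank hint, ← hmin, natDegree_X_pow_sub_C]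

end SqrtExt

/-! ### What a trivial specialization represents, and congruences of polynomial values. -/

section Specialization

variable {K : Type*} [Field K] [NumberField K] {S : Set (HeightOneSpectrum (𝓞 K))}

/-- The specialized form takes the value `A(n)` at `(1, 0)`; pulling this vector back by `M` gives a
value of the principal form, with `u = (det M)⁻¹`. -/
theorem exists_unit_mul_eq_of_mem_trivialSpecializations {f : (𝓞 K)[X]}
    {q : BinForm (S.integer K)[X]} {n : S.integer K} (hn : n ∈ trivialSpecializations f q) :
    ∃ (u : (S.integer K)ˣ) (x y : S.integer K),
      (u : S.integer K) * q.a.eval n = x ^ 2 - aeval n f * y ^ 2 := by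
  obtain ⟨M, hM⟩ := hn
  -- the value of the form at `M⁻¹ (1, 0)`
  have key := BinForm.eval_twistedAct M (q.map (evalRingHom n)) (M⁻¹ 0 0) (M⁻¹ 1 0)
  have h : (M * M⁻¹ : GL (Fin 2) (S.integer K)) = 1 := mul_inv_cancel M
  have h00 : M 0 0 * M⁻¹ 0 0 + M 0 1 * M⁻¹ 1 0 = 1 := by
    have := congrArg (fun N : GL (Fin 2) (S.integer K) => N 0 0) h
    simpa only [Matrix.GeneralLinearGroup.coe_mul, Matrix.mul_apply, Fin.sum_univ_two,
      Matrix.GeneralLinearGroup.coe_one, Matrix.one_apply_eq] using this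
  have h10 : M 1 0 * M⁻¹ 0 0 + M 1 1 * M⁻¹ 1 0 = 0 := by
    have := congrArg (fun N : GL (Fin 2) (S.integer K) => N 1 0) h
    simpa only [Matrix.GeneralLinearGroup.coe_mul, Matrix.mul_apply, Fin.sum_univ_two,
      Matrix.GeneralLinearGroup.coe_one, Matrix.one_apply_ne one_ne_zero] using this
  rw [← hM, h00, h10] at key
  refine ⟨(Matrix.GeneralLinearGroup.det M)⁻¹, M⁻¹ 0 0, M⁻¹ 1 0, ?_⟩
  simp only [BinForm.eval, BinForm.principal, BinForm.map, coe_evalRingHom] at key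
  linear_combination -key

end Specialization

section Valuation

variable {R F Γ₀ : Type*} [CommRing R] [Field F] [LinearOrderedCommGroupWithZero Γ₀]

theorem Valuation.eval₂_le_one (w : Valuation F Γ₀) {φ : R →+* F} (hφ : ∀ r, w (φ r) ≤ 1) {t : F}
    (ht : w t ≤ 1) (p : R[X]) : w (eval₂ φ t p) ≤ 1 := by
  rw [eval₂_eq_sum_range]
  refine w.map_sum_le fun i _ => ?_
  rw [map_mul, map_pow]
  exact mul_le_one' (hφ _) (pow_le_one' ht i)

theorem Valuation.map_eval_sub_eval₂_lt_one (w : Valuation F Γ₀) {φ : R →+* F}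
    (hφ : ∀ r, w (φ r) ≤ 1) {t : F} (ht : w t ≤ 1) {n : R} (hn : w (φ n - t) < 1) (p : R[X]) :
    w (φ (p.eval n) - eval₂ φ t p) < 1 := by
  induction p using Polynomial.induction_on with
  | C a => simp
  | add p q hp hq =>
    rw [eval_add, map_add, eval₂_add, add_sub_add_comm]
    exact w.map_add_lt hp hq
  | monomial k a h =>
    have h1 : w (φ n * (φ ((C a * X ^ k).eval n) - eval₂ φ t (C a * X ^ k))) < 1 := by
      rw [map_mul]
      exact (mul_le_of_le_one_left' (hφ n)).trans_lt h
    have h2 : w (φ a * t ^ k * (φ n - t)) < 1 := by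
      rw [map_mul, map_mul, map_pow]
      exact (mul_le_of_le_one_left' (mul_le_one' (hφ a) (pow_le_one' ht k))).trans_lt hn
    have h3 : φ ((C a * X ^ (k + 1)).eval n) - eval₂ φ t (C a * X ^ (k + 1)) =
        φ n * (φ ((C a * X ^ k).eval n) - eval₂ φ t (C a * X ^ k)) + φ a * t ^ k * (φ n - t) := by
      simp only [eval_mul, eval_C, eval_pow, eval_X, eval₂_mul, eval₂_C, eval₂_X_pow, map_mul,
        map_pow]
      ring
    rw [h3]
    exact w.map_add_lt h1 h2

end Valuation

/-! ### Density zero for each unit. -/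

section Density

variable {K : Type*} [Field K] [NumberField K] {S : Set (HeightOneSpectrum (𝓞 K))}

theorem valuation_algebraMap_integer_le_one {F : Type*} [Field F] [NumberField F] [Algebra K F]
    {v : HeightOneSpectrum (𝓞 F)} (hv : v ∉ primesOver S F) (r : S.integer K) :
    v.valuation F (algebraMap K F r) ≤ 1 :=
  valuation_algebraMap_le_one_of_under v (r.2 _ fun h =>
    hv ⟨_, h, HeightOneSpectrum.under_eq_iff.mp rfl⟩)

variable {f : (𝓞 K)[X]} {A : (S.integer K)[X]} {u : (S.integer K)ˣ} {ρ : AlgebraicClosure K}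

theorem aeval_gen_eq_zero (hρ : aeval ρ f = 0) : aeval (AdjoinSimple.gen K ρ) f = 0 := by
  apply (algebraMap K⟮ρ⟯ (AlgebraicClosure K)).injective
  rw [aeval_def] at hρ ⊢
  rw [hom_eval₂, AdjoinSimple.algebraMap_gen, map_zero]
  exact hρ

theorem isIntegral_gen (hmonic : f.Monic) (hρ : aeval ρ f = 0) :
    IsIntegral ℤ (AdjoinSimple.gen K ρ) :=
  have : IsScalarTower ℤ (𝓞 K) K⟮ρ⟯ := IsScalarTower.of_algebraMap_eq' (RingHom.ext_int _ _)
  isIntegral_trans (A := 𝓞 K) _ ⟨f, hmonic, aeval_gen_eq_zero hρ⟩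

theorem valuation_gen_le_one (hmonic : f.Monic) (hρ : aeval ρ f = 0)
    (v : HeightOneSpectrum (𝓞 K⟮ρ⟯)) : v.valuation K⟮ρ⟯ (AdjoinSimple.gen K ρ) ≤ 1 :=
  v.valuation_le_one (⟨_, isIntegral_gen hmonic hρ⟩ : 𝓞 K⟮ρ⟯)

theorem valueAt_eq : valueAt A u ρ = algebraMap K K⟮ρ⟯ (u : S.integer K) *
    eval₂ ((algebraMap K K⟮ρ⟯).comp (algebraMap (S.integer K) K)) (AdjoinSimple.gen K ρ) A := rfl

theorem valuation_valueAt_le_one (hmonic : f.Monic) (hρ : aeval ρ f = 0)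
    {v : HeightOneSpectrum (𝓞 K⟮ρ⟯)} (hv : v ∉ primesOver S K⟮ρ⟯) :
    v.valuation K⟮ρ⟯ (valueAt A u ρ) ≤ 1 := by
  rw [valueAt_eq, map_mul]
  exact mul_le_one' (valuation_algebraMap_integer_le_one hv _)
    (Valuation.eval₂_le_one _ (valuation_algebraMap_integer_le_one hv)
      (valuation_gen_le_one hmonic hρ v) A)

/-- The value is integral outside `S`, hence so is any square root of it: being a nonsquare among
the integers is being a nonsquare in the field. -/
theorem IsNonsquareRoot.not_exists_sq (hmonic : f.Monic) (h : IsNonsquareRoot f A u ρ) :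
    ¬ ∃ y : K⟮ρ⟯, y ^ 2 = valueAt A u ρ := by
  rintro ⟨y, hy⟩
  refine h.2 ⟨y, fun v hv => ?_, hy⟩
  have := valuation_valueAt_le_one (A := A) (u := u) hmonic h.1 hv
  rw [← hy, map_pow] at this
  exact (pow_le_one_iff two_ne_zero).mp this

theorem IsNonsquareRoot.valueAt_ne_zero (h : IsNonsquareRoot f A u ρ) : valueAt A u ρ ≠ 0 :=
  fun h0 => h.2 ⟨0, zero_mem _, by rw [h0, zero_pow two_ne_zero]⟩

/-- When `n ≡ ρ` modulo `v`, the term `f(n) y²` vanishes modulo `v` and `A(n) ≡ A(ρ)`. -/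
theorem valuation_sq_sub_valueAt_lt_one (hmonic : f.Monic) (hρ : aeval ρ f = 0)
    {v : HeightOneSpectrum (𝓞 K⟮ρ⟯)} (hv : v ∉ primesOver S K⟮ρ⟯) {n x y : S.integer K}
    (hxy : (u : S.integer K) * A.eval n = x ^ 2 - aeval n f * y ^ 2)
    (hn : v.valuation K⟮ρ⟯ (algebraMap K K⟮ρ⟯ n - AdjoinSimple.gen K ρ) < 1) :
    v.valuation K⟮ρ⟯ (algebraMap K K⟮ρ⟯ x ^ 2 - valueAt A u ρ) < 1 := by
  set φ : S.integer K →+* K⟮ρ⟯ := (algebraMap K K⟮ρ⟯).comp (algebraMap (S.integer K) K)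
  have hφ : ∀ r, v.valuation K⟮ρ⟯ (φ r) ≤ 1 := valuation_algebraMap_integer_le_one hv
  have ht := valuation_gen_le_one hmonic hρ v
  have hA := Valuation.map_eval_sub_eval₂_lt_one _ hφ ht hn A
  have hf := Valuation.map_eval_sub_eval₂_lt_one _ hφ ht hn (f.map (algebraMap (𝓞 K) (S.integer K)))
  have hf0 : eval₂ φ (AdjoinSimple.gen K ρ) (f.map (algebraMap (𝓞 K) (S.integer K))) = 0 := by
    rw [eval₂_map]
    exact aeval_gen_eq_zero hρ
  rw [hf0, sub_zero, eval_map_algebraMap] at hf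
  have heq : algebraMap K K⟮ρ⟯ x ^ 2 - valueAt A u ρ =
      φ u * (φ (A.eval n) - eval₂ φ (AdjoinSimple.gen K ρ) A) + φ (aeval n f) * φ y ^ 2 := by
    have h := congrArg φ hxy
    rw [map_mul, map_sub, map_mul, map_pow, map_pow] at h
    have h' : valueAt A u ρ = φ u * eval₂ φ (AdjoinSimple.gen K ρ) A := rfl
    have h'' : algebraMap K K⟮ρ⟯ x = φ x := rfl
    rw [h', h'']
    linear_combination -h
  rw [heq]
  refine Valuation.map_add_lt _ ?_ ?_
  · rw [map_mul]
    exact (mul_le_of_le_one_left' (hφ _)).trans_lt hA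
  · rw [map_mul, map_pow]
    exact (mul_le_of_le_one_right' (pow_le_one' (hφ y) 2)).trans_lt hf

theorem finite_primesOver (hS : S.Finite) (F : Type*) [Field F] [NumberField F] [Algebra K F] :
    (primesOver S F).Finite := by
  have : primesOver S F = ⋃ q ∈ S, {v : HeightOneSpectrum (𝓞 F) | v.asIdeal.LiesOver q.asIdeal} := by
    ext v
    simp [primesOver]
  rw [this]
  refine hS.biUnion fun q _ => ?_
  have := q.isMaximal
  refine Set.Finite.of_injOn (f := HeightOneSpectrum.asIdeal) (t := q.asIdeal.primesOver (𝓞 F))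
    (fun v hv => ⟨v.isPrime, hv⟩) (fun v _ w _ h => HeightOneSpectrum.ext h)
    (IsDedekindDomain.primesOver_finite q.asIdeal (𝓞 F))

theorem HeightOneSpectrum.finite_valuation_ne_one {F : Type*} [Field F] [NumberField F] {d : F}
    (hd : d ≠ 0) : {v : HeightOneSpectrum (𝓞 F) | v.valuation F d ≠ 1}.Finite := by
  refine ((HeightOneSpectrum.Support.finite (𝓞 F) d).union
    (HeightOneSpectrum.Support.finite (𝓞 F) d⁻¹)).subset fun v hv => ?_
  rcases lt_or_gt_of_ne hv with h | h
  · right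
    change 1 < v.valuation F d⁻¹
    rw [map_inv₀]
    exact (one_lt_inv₀ (zero_lt_iff.mpr ((v.valuation F).ne_zero_iff.mpr hd))).mpr h
  · exact Or.inl h

/-- A set of `S`-integers incongruent to `z` modulo each of finitely many primes of degree one lying
over distinct primes of `K`. -/
theorem IsDensity.le_prod_of_forall_not_valuation_sub_lt_one {F : Type*} [Field F] [NumberField F]
    [Algebra K F] {δ : Set (S.integer K) → ℝ} (hδ : IsDensity δ)
    (T : Finset (HeightOneSpectrum (𝓞 F))) (hT : ∀ v ∈ T, v.asIdeal.inertiaDeg (𝓞 K) = 1)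
    (hTS : ∀ v ∈ T, v.under (𝓞 K) ∉ S)
    (hTinj : Set.InjOn (fun v => v.under (𝓞 K)) (T : Set (HeightOneSpectrum (𝓞 F)))) (z : 𝓞 F)
    (X : Set (S.integer K))
    (hX : ∀ n ∈ X, ∀ v ∈ T, ¬ v.valuation F (algebraMap K F n - algebraMap (𝓞 F) F z) < 1) :
    δ X ≤ ∏ v ∈ T, (1 - 1 / (Ideal.absNorm v.asIdeal : ℝ)) := by
  classical
  have hinf : Infinite (S.integer K) := Infinite.of_injective (algebraMap (𝓞 K) (S.integer K))
    fun a b hab => RingOfIntegers.ext (congrArg (algebraMap (S.integer K) K) hab)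
  have hn0 : ∀ v : HeightOneSpectrum (𝓞 F), ∃ a : 𝓞 K, v ∈ T →
      v.valuation F (algebraMap K F (algebraMap (𝓞 K) K a) - algebraMap (𝓞 F) F z) < 1 := by
    intro v
    by_cases hv : v ∈ T
    · obtain ⟨a, ha⟩ := exists_sub_mem_of_inertiaDeg_eq_one v (hT v hv) z
      refine ⟨a, fun _ => ?_⟩
      have := (v.valuation_lt_one_iff_mem (K := F) _).mpr ha
      change v.valuation F (algebraMap (𝓞 F) F _) < 1 at this
      rwa [map_sub, ← IsScalarTower.algebraMap_apply (𝓞 K) (𝓞 F) F,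
        IsScalarTower.algebraMap_apply (𝓞 K) K F] at this
    · exact ⟨0, fun h => (hv h).elim⟩
  choose a ha using hn0
  let P : HeightOneSpectrum (𝓞 F) → Ideal (S.integer K) := fun v =>
    if hv : v.under (𝓞 K) ∈ S then ⊤ else sIntegerPrime S (v.under (𝓞 K)) hv
  have hP : ∀ v (hv : v ∈ T), P v = sIntegerPrime S (v.under (𝓞 K)) (hTS v hv) :=
    fun v hv => dif_neg (hTS v hv)
  refine (hδ.le_prod_one_sub T P (fun v hv => ?_) ?_ (fun v hv => ?_)
    (fun v => algebraMap (𝓞 K) (S.integer K) (a v)) _ ?_).trans (le_of_eq ?_)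
  · rw [hP v hv]
    exact isMaximal_sIntegerPrime _ _ _
  · intro v hv w hw hvw
    refine hTinj hv hw (HeightOneSpectrum.ext ?_)
    rw [hP v hv, hP w hw] at hvw
    rw [← comap_sIntegerPrime S _ (hTS v hv), ← comap_sIntegerPrime S _ (hTS w hw), hvw]
  · rw [hP v hv]
    exact finite_quotient_sIntegerPrime _ _ _
  · intro n hnX v hv hmem
    rw [hP v hv, mem_sIntegerPrime] at hmem
    refine hX n hnX v hv ?_
    have h2 := Valuation.map_add_lt _ (valuation_algebraMap_lt_one_of_under v hmem) (ha v hv)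
    have h3 : algebraMap K F ((n - algebraMap (𝓞 K) (S.integer K) (a v) : S.integer K) : K) =
        algebraMap K F n - algebraMap K F (algebraMap (𝓞 K) K (a v)) := by
      rw [AddSubgroupClass.coe_sub, map_sub]
      rfl
    rwa [h3, sub_add_sub_cancel] at h2
  · refine Finset.prod_congr rfl fun v hv => ?_
    have hlies : v.asIdeal.LiesOver (v.under (𝓞 K)).asIdeal :=
      HeightOneSpectrum.under_eq_iff.mp rfl
    have hN := Ideal.absNorm_pow_inertiaDeg (v.under (𝓞 K)).asIdeal v.asIdeal
    rw [hT v hv, pow_one] at hN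
    rw [hP v hv, card_quotient_sIntegerPrime, hN]

/-- The set of `n` such that `u A(n)` is represented by `x² - f(n) y²` has density zero. -/
theorem IsNonsquareRoot.density_eq_zero (hmonic : f.Monic) (hS : S.Finite)
    {δ : Set (S.integer K) → ℝ} (hδ : IsDensity δ) (h : IsNonsquareRoot f A u ρ) :
    δ {n | ∃ x y : S.integer K, (u : S.integer K) * A.eval n = x ^ 2 - aeval n f * y ^ 2} = 0 := by
  set d := valueAt A u ρ with hd
  have hdsq := h.not_exists_sq hmonic
  have hd0 := h.valueAt_ne_zero
  obtain ⟨s, hs⟩ := IsAlgClosed.exists_pow_nat_eq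
    (algebraMap K⟮ρ⟯ (AlgebraicClosure K) d) two_pos
  have hrank := finrank_sqrtExt (Ω := AlgebraicClosure K) d hdsq hs
  have : FiniteDimensional K⟮ρ⟯ (sqrtExt (Ω := AlgebraicClosure K) d) :=
    Module.finite_of_finrank_eq_succ hrank
  have : NumberField (sqrtExt (Ω := AlgebraicClosure K) d) :=
    NumberField.of_module_finite K⟮ρ⟯ _
  have : Algebra.IsQuadraticExtension K⟮ρ⟯ (sqrtExt (Ω := AlgebraicClosure K) d) := ⟨hrank⟩
  have hgal : IsGalois K⟮ρ⟯ (sqrtExt (Ω := AlgebraicClosure K) d) := inferInstance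
  have hsmem : s ∈ sqrtExt (Ω := AlgebraicClosure K) d := subset_adjoin _ _ hs
  have hs' : (⟨s, hsmem⟩ : sqrtExt (Ω := AlgebraicClosure K) d) ^ 2 = algebraMap _ _ d :=
    Subtype.ext hs
  -- Dropping the primes above `2` and those where `d` is not a unit removes finitely many, so the
  -- divergence is unaffected.
  set G : Set (HeightOneSpectrum (𝓞 K⟮ρ⟯)) := {v | v ∈ inertPrimes A u ρ ∧ (2 : 𝓞 K⟮ρ⟯) ∉ v.asIdeal ∧
    v.valuation K⟮ρ⟯ d = 1} with hG
  have hGsum : ¬ Summable (G.indicator fun v => 1 / (Ideal.absNorm v.asIdeal : ℝ)) := by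
    intro hsum
    refine not_summable_inert (F := K⟮ρ⟯) (F' := sqrtExt (Ω := AlgebraicClosure K) d) K hrank ?_
    have hbad : (primesOver S K⟮ρ⟯ ∪ {v | v.valuation K⟮ρ⟯ (2 : K⟮ρ⟯) ≠ 1} ∪
        {v | v.valuation K⟮ρ⟯ d ≠ 1}).Finite :=
      ((finite_primesOver hS _).union
        (HeightOneSpectrum.finite_valuation_ne_one two_ne_zero)).union
        (HeightOneSpectrum.finite_valuation_ne_one hd0)
    refine (summable_congr_cofinite ?_).mp hsum
    filter_upwards [hbad.compl_mem_cofinite] with v hv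
    simp only [Set.mem_compl_iff, Set.mem_union, Set.mem_ofPred_eq, not_or, not_not] at hv
    have h2v : (2 : 𝓞 K⟮ρ⟯) ∉ v.asIdeal := by
      have := v.valuation_eq_one_iff_notMem (K := K⟮ρ⟯) (r := 2)
      rw [map_ofNat] at this
      exact this.mp hv.1.2
    by_cases hvG : v ∈ G
    · rw [Set.indicator_of_mem hvG, Set.indicator_of_mem]
      exact hvG.1.2
    · rw [Set.indicator_of_notMem hvG, Set.indicator_of_notMem]
      exact fun hmem => hvG ⟨⟨hv.1.1, hmem⟩, h2v, hv.2⟩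
  refine le_antisymm (le_of_forall_pos_le_add fun ε hε => ?_) (hδ.mem_Icc _).1
  rw [zero_add]
  obtain ⟨T, hTG, hTinj, hTlt⟩ := exists_finset_prod_lt (K := K) G (fun v hv => hv.1.2.1) hGsum hε
  refine le_trans ?_ hTlt.le
  refine hδ.le_prod_of_forall_not_valuation_sub_lt_one T (fun v hv => (hTG v hv).1.2.1)
    (fun v hv hvS => (hTG v hv).1.1 ⟨_, hvS, HeightOneSpectrum.under_eq_iff.mp rfl⟩) hTinj
    ⟨_, isIntegral_gen hmonic h.1⟩ _ ?_
  rintro n ⟨x, y, hxy⟩ v hv hlt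
  have hvG := hTG v hv
  exact not_valuation_sq_sub_lt_one hs' hdsq v hvG.1.2.2 hvG.2.1 hvG.2.2
    (valuation_algebraMap_integer_le_one hvG.1.1 x)
    (valuation_sq_sub_valueAt_lt_one hmonic h.1 hvG.1.1 hxy hlt)

end Density

/-! ### Convergence of the products and conclusion. -/

/-- Finite products decrease as factors are added and are bounded below by `0`, so they converge to
their infimum, which may be `0`. -/
theorem multipliable_of_mem_Icc {ι : Type*} {g : ι → ℝ} (hg : ∀ i, g i ∈ Set.Icc (0 : ℝ) 1) :
    Multipliable g := by
  classical
  refine ⟨⨅ s : Finset ι, ∏ i ∈ s, g i, tendsto_atTop_ciInf (fun s t hst => ?_) ⟨0, ?_⟩⟩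
  · exact Finset.prod_le_prod_of_subset_of_le_one hst (fun i _ => (hg i).1) fun i _ _ => (hg i).2
  · rintro _ ⟨s, rfl⟩
    exact Finset.prod_nonneg fun i _ => (hg i).1

theorem tprod_nonneg_of_mem_Icc {ι : Type*} {g : ι → ℝ} (hg : ∀ i, g i ∈ Set.Icc (0 : ℝ) 1) :
    0 ≤ ∏' i, g i :=
  ge_of_tendsto' (multipliable_of_mem_Icc hg).hasProd fun _ =>
    Finset.prod_nonneg fun i _ => (hg i).1

section Main

variable {K : Type*} [Field K] [NumberField K]

theorem one_sub_one_div_absNorm_mem_Icc (v : HeightOneSpectrum (𝓞 K)) :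
    1 - 1 / (Ideal.absNorm v.asIdeal : ℝ) ∈ Set.Icc (0 : ℝ) 1 := by
  have h : (1 : ℝ) ≤ Ideal.absNorm v.asIdeal := by
    exact_mod_cast one_le_two.trans (two_le_absNorm v)
  exact ⟨sub_nonneg.mpr ((div_le_one (by positivity)).mpr h), sub_le_self _ (by positivity)⟩

variable {f : (𝓞 K)[X]} {S : Set (HeightOneSpectrum (𝓞 K))} {A B C : (S.integer K)[X]}

/-- If `u A` were a square at every root, `exists_dvd_sq_sub` would make it a square modulo `f`, and
`BinForm.inPrincipalGenus_of_dvd` would contradict `hgenus`. -/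
theorem exists_isNonsquareRoot (hmonic : f.Monic) (hsq : Squarefree f)
    (hdisc : (BinForm.mk A (2 * B) C).disc = 4 * f.map (algebraMap (𝓞 K) (S.integer K)))
    (hcop : IsCoprime (A.map (algebraMap (S.integer K) K)) (f.map (algebraMap (𝓞 K) K)))
    (hgenus : ¬ BinForm.InPrincipalGenus (f.map (algebraMap (𝓞 K) K))
      ((BinForm.mk A (2 * B) C).map (mapRingHom (algebraMap (S.integer K) K))))
    (u : (S.integer K)ˣ) : ∃ ρ : AlgebraicClosure K, IsNonsquareRoot f A u ρ := by
  by_contra! hcon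
  let ψ : S.integer K →+* K := algebraMap (S.integer K) K
  let e : K[X]ˣ := Units.map (Polynomial.C.comp ψ : S.integer K →+* K[X]) u
  have h4 : IsUnit (4 : K[X]) := by
    have : (4 : K[X]) = Polynomial.C 4 := (map_ofNat _ 4).symm
    rw [this]
    exact isUnit_C.mpr (isUnit_iff_ne_zero.mpr (by norm_num))
  obtain ⟨z, hz⟩ := exists_dvd_sq_sub ((e : K[X]) * A.map ψ) _ (hmonic.squarefree_map K hsq)
    fun ρ hρ => by
      have hρ' : aeval ρ f = 0 := by
        rw [aeval_map_algebraMap] at hρ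
        exact hρ
      by_contra hne
      refine hcon ρ ⟨hρ', fun ⟨y, _, hy⟩ => hne ⟨y, ?_⟩⟩
      rw [hy, valueAt_eq, map_mul, aeval_def, aeval_def, eval₂_map]
      congr 1
      exact (eval₂_C _ _).symm
  refine hgenus ?_
  have hmap : (BinForm.mk A (2 * B) C).map (mapRingHom ψ) =
      ⟨A.map ψ, 2 * B.map ψ, C.map ψ⟩ := by
    simp [BinForm.map]
  rw [hmap]
  refine BinForm.inPrincipalGenus_of_dvd e h4 ?_ hcop hz
  have h := congrArg (mapRingHom ψ) hdisc
  have hf : mapRingHom ψ (f.map (algebraMap (𝓞 K) (S.integer K))) = f.map (algebraMap (𝓞 K) K) := by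
    rw [coe_mapRingHom, Polynomial.map_map]
    rfl
  simp only [BinForm.disc, map_sub, map_mul, map_pow, map_ofNat, hf] at h
  simp only [coe_mapRingHom] at h
  refine h4.mul_left_cancel ?_
  linear_combination h

theorem density_trivialSpecializations_eq_zero (hmonic : f.Monic) (hS : S.Finite)
    {δ : Set (S.integer K) → ℝ} (hδ : IsDensity δ)
    (h : ∀ u : (S.integer K)ˣ, ∃ ρ : AlgebraicClosure K, IsNonsquareRoot f A u ρ) (b c) :
    δ (trivialSpecializations f ⟨A, b, c⟩) = 0 := by
  have hfin := finite_units_quotient_square S hS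
  have := Fintype.ofFinite ((S.integer K)ˣ ⧸ Subgroup.square (S.integer K)ˣ)
  have hinf : Infinite (S.integer K) := Infinite.of_injective (algebraMap (𝓞 K) (S.integer K))
    fun a b hab => RingOfIntegers.ext (congrArg (algebraMap (S.integer K) K) hab)
  let X : (S.integer K)ˣ → Set (S.integer K) := fun u =>
    {n | ∃ x y : S.integer K, (u : S.integer K) * A.eval n = x ^ 2 - aeval n f * y ^ 2}
  have hsub : trivialSpecializations f ⟨A, b, c⟩ ⊆
      ⋃ ε ∈ (Finset.univ : Finset ((S.integer K)ˣ ⧸ Subgroup.square (S.integer K)ˣ)),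
        X ε.out := by
    intro n hn
    obtain ⟨u, x, y, hxy⟩ := exists_unit_mul_eq_of_mem_trivialSpecializations hn
    have hout : (QuotientGroup.mk u : (S.integer K)ˣ ⧸ Subgroup.square (S.integer K)ˣ) =
      QuotientGroup.mk (QuotientGroup.mk u : _ ⧸ Subgroup.square (S.integer K)ˣ).out :=
      (QuotientGroup.out_eq' _).symm
    obtain ⟨t, ht⟩ := Subgroup.mem_square.mp (QuotientGroup.eq.mp hout)
    simp only [Set.mem_iUnion, Finset.mem_univ, exists_prop, true_and]
    -- The chosen representative is `u t²`, and `t²` is absorbed into `x` and `y`.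
    refine ⟨QuotientGroup.mk u, t * x, t * y, ?_⟩
    have ht' := congrArg (Units.val) (inv_mul_eq_iff_eq_mul.mp ht)
    rw [ht']
    push_cast
    linear_combination (t : S.integer K) ^ 2 * hxy
  refine le_antisymm ?_ (hδ.mem_Icc _).1
  refine ((hδ.mono _ _ hsub).trans (hδ.biUnion_le _ _)).trans (le_of_eq ?_)
  refine Finset.sum_eq_zero fun ε _ => ?_
  obtain ⟨ρ, hρ⟩ := h ε.out
  exact hρ.density_eq_zero hmonic hS hδ

end Main

theorem mainTheorem6 {K : Type*} [Field K] [NumberField K]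
    (f : (𝓞 K)[X]) (hmonic : f.Monic) (hsq : Squarefree f)
    (hodd : Odd f.natDegree) (hdeg : 3 ≤ f.natDegree)
    (S : Set (HeightOneSpectrum (𝓞 K))) (hS : S.Finite)
    (hPID : IsPrincipalIdealRing (S.integer K))
    (δ : Set (S.integer K) → ℝ) (hδ : IsDensity δ)
    (A B C : (S.integer K)[X])
    (hprim : (BinForm.mk A (2 * B) C).IsPrimitive)
    (hdisc : (BinForm.mk A (2 * B) C).disc = 4 * f.map (algebraMap (𝓞 K) (S.integer K)))
    (hcop : IsCoprime (A.map (algebraMap (S.integer K) K)) (f.map (algebraMap (𝓞 K) K)))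
    (hgenus : ¬ BinForm.InPrincipalGenus (f.map (algebraMap (𝓞 K) K))
      ((BinForm.mk A (2 * B) C).map (mapRingHom (algebraMap (S.integer K) K)))) :
    Finite ((S.integer K)ˣ ⧸ Subgroup.square (S.integer K)ˣ) ∧
    (∀ u : (S.integer K)ˣ, ∃ ρ : AlgebraicClosure K, IsNonsquareRoot f A u ρ) ∧
    ∀ (e : (S.integer K)ˣ ⧸ Subgroup.square (S.integer K)ˣ → (S.integer K)ˣ)
      (_ : ∀ ε, (QuotientGroup.mk (e ε) : (S.integer K)ˣ ⧸ Subgroup.square (S.integer K)ˣ) = ε)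
      (ρ : (S.integer K)ˣ ⧸ Subgroup.square (S.integer K)ˣ → AlgebraicClosure K)
      (_ : ∀ ε, IsNonsquareRoot f A (e ε) (ρ ε)),
      (∀ ε, Multipliable fun 𝔭 : inertPrimes A (e ε) (ρ ε) =>
        1 - 1 / (Ideal.absNorm 𝔭.1.asIdeal : ℝ)) ∧
      δ (trivialSpecializations f (BinForm.mk A (2 * B) C)) ≤
        ∑' ε, ∏' 𝔭 : inertPrimes A (e ε) (ρ ε), (1 - 1 / (Ideal.absNorm 𝔭.1.asIdeal : ℝ)) := by
  have hex := exists_isNonsquareRoot hmonic hsq hdisc hcop hgenus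
  refine ⟨finite_units_quotient_square S hS, hex, fun e _ ρ _ =>
    ⟨fun ε => multipliable_of_mem_Icc fun 𝔭 => one_sub_one_div_absNorm_mem_Icc 𝔭.1, ?_⟩⟩
  -- The density is exactly zero, so nonnegativity of the right side is all that remains.
  rw [density_trivialSpecializations_eq_zero hmonic hS hδ hex]
  exact tsum_nonneg fun ε => tprod_nonneg_of_mem_Icc fun 𝔭 => one_sub_one_div_absNorm_mem_Icc 𝔭.1
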